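/- Lemma 4.1. Conventions. For $\boldsymbol\theta=(\theta_0,\theta_1,\theta_t,\theta_\infty)\in\mathbb C^4$ with $\theta_\infty\ne0$, a *JMU $\tau$-function of Painlevé VI with parameters $\boldsymbol\theta$* is an analytic function $\tau\not\equiv0$ on $(0,1)$ such that $$\frac{d}{dt}\ln\tau=\frac{\operatorname{tr}(A_0A_t)}{t}+\frac{\operatorname{tr}(A_1A_t)}{t-1}$$ for a meromorphic solution on $(0,1)$ of the Schlesinger system $A_0'=\frac{[A_t,A_0]}{t}$, $A_1'=\frac{[A_t,A_1]}{t-1}$, where $A_\nu(t)\in\mathfrak{sl}_2(\mathbb C)$ has eigenvalues $\pm\theta_\nu/2$ ($\nu=0,1,t$) and $A_0+A_1+A_t=\mathrm{diag}(-\theta_\infty/2,\theta_\infty/2)$. The sixth Painlevé equation (PVI) with parameters $\boldsymbol\theta$ is $$q''=\tfrac12\Bigl(\tfrac1q+\tfrac1{q-1}+\tfrac1{q-t}\Bigr)q'^2-\Bigl(\tfrac1t+\tfrac1{t-1}+\tfrac1{q-t}\Bigr)q'+\tfrac{q(q-1)(q-t)}{2t^2(t-1)^2}\Bigl((\theta_\infty-1)^2-\tfrac{\theta_0^2t}{q^2}+\tfrac{\theta_1^2(t-1)}{(q-1)^2}+\tfrac{(1-\theta_t^2)t(t-1)}{(q-t)^2}\Bigr).$$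 *Hypergeometric kernel determinant.* Let $z,z',w,w'\in\mathbb C$ with $w\neq w'$, $\operatorname{Re}(z+z'+w+w')>0$ and $z+w,\,z+w',\,z'+w,\,z'+w'\notin\mathbb Z_{<0}$. The (${}_2F_1$ kernel) determinant $D(t)$, $t\in(0,1)$, is defined as the JMU $\tau$-function of PVI with parameters $\boldsymbol\theta=(z+z'+w+w',\,z-z',\,0,\,w-w')$ such that, as $t\to0^+$, $$D(t)=1-\kappa\,t^{1+z+z'+w+w'}+O\bigl(t^{2+z+z'+w+w'}\bigr),$$ $$\kappa=\frac{\sin\pi z\,\sin\pi z'}{\pi^2}\,\frac{\Gamma(1+z+w)\Gamma(1+z+w')\Gamma(1+z'+w)\Gamma(1+z'+w')}{\Gamma(2+z+z'+w+w')^2}.$$ *Palmer–Beatty–Tracy $\tau$-function.* Let $-1<\nu_1,\nu_2<0$ (Aharonov–Bohm fluxes), $b\in\mathbb R$ (magnetic field parameter) and $\mu\in\mathbb C$ (energy parameter). $\tau_{PBT}(s)$, $s\in(0,1)$, is an analytic function, not identically $0$, such that for some meromorphic solution $u(s)$, not identically $0$, $1$ or $s$, of PVI (in the variable $s$ instead of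 $t$) with parameters $\boldsymbol\theta=(1+\nu_1+\nu_2-2b,\,0,\,2\mu,\,1+\nu_1-\nu_2)$ one has $$\frac{d}{ds}\ln\tau_{PBT}(s)=\frac{s(1-s)}{4u(1-u)(u-s)}\Bigl(\frac{du}{ds}-\frac{1-u}{1-s}\Bigr)^2-\frac{1-u}{1-s}\Bigl(\frac{(\theta_\infty-1)^2}{4s}-\frac{(\theta_0+1)^2}{4u}+\frac{\theta_t^2}{4(u-s)}\Bigr),$$ and, as $s\to1^-$, $$\tau_{PBT}(s)=1-\kappa_{PBT}(1-s)^{1+2\mu}+O\bigl((1-s)^{2+2\mu}\bigr),$$ $$\kappa_{PBT}=\frac{\sin\pi\nu_1\sin\pi\nu_2}{\pi^2}\,\frac{\Gamma(2+\mu+\nu_1-b)\Gamma(\mu-\nu_1+b)\Gamma(2+\mu+\nu_2-b)\Gamma(\mu-\nu_2+b)}{\Gamma(2+2\mu)^2}.$$ **Lemma.** Suppose that the parameters are related by $$z+z'+w+w'=2\mu,\qquad z-z'=\nu_1-\nu_2,\qquad w-w'=2+\nu_1+\nu_2-2b,\qquad \cos\pi(z+z')=\cos\pi(\nu_1+\nu_2).$$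 If $D$ and $\tau_{PBT}$ are functions as above, then $D(t)=\tau_{PBT}(1-t)$ for all $t\in(0,1)$. -/

import Mathlib

open Filter Topology Asymptotics Set

noncomputable section

namespace PVI

/-- The parameters `(θ₀, θ₁, θ_t, θ_∞)` of the sixth Painlevé equation. -/
structure Params where
  zero : ℂ
  one : ℂ
  t : ℂ
  inf : ℂ

/-- A property holds at all points of `(0,1)` outside a subset that is discrete and relatively
closed in `(0,1)`. It is used to allow for the (movable) poles of solutions. -/
def OffDiscrete (P : ℝ → Prop) : Prop :=
  ∀ᶠ t in codiscreteWithin (Ioo (0 : ℝ) 1), P t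

/-- `A` is in `𝔰𝔩₂(ℂ)` and has eigenvalues `±θ/2`. -/
def HasExponent (A : Matrix (Fin 2) (Fin 2) ℂ) (θ : ℂ) : Prop :=
  A.trace = 0 ∧ A.det = -(θ / 2) ^ 2

/-- `(A₀, A₁, A_t)` is a (meromorphic) solution on `(0,1)` of the Schlesinger system
`A₀' = [A_t, A₀] / t`, `A₁' = [A_t, A₁] / (t - 1)`, in which `A_ν` has eigenvalues `±θ_ν / 2`
and `A₀ + A₁ + A_t = diag (-θ_∞/2, θ_∞/2)` with `θ_∞ ≠ 0`. -/
structure IsSchlesingerSolution (θ : Params) (A₀ A₁ Aₜ : ℝ → Matrix (Fin 2) (Fin 2) ℂ) :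
    Prop where
  inf_ne_zero : θ.inf ≠ 0
  mero_zero : ∀ i j, MeromorphicOn (fun t => A₀ t i j) (Ioo 0 1)
  mero_one : ∀ i j, MeromorphicOn (fun t => A₁ t i j) (Ioo 0 1)
  mero_t : ∀ i j, MeromorphicOn (fun t => Aₜ t i j) (Ioo 0 1)
  exponents : OffDiscrete fun t =>
    HasExponent (A₀ t) θ.zero ∧ HasExponent (A₁ t) θ.one ∧ HasExponent (Aₜ t) θ.t
  sum_eq : OffDiscrete fun t => A₀ t + A₁ t + Aₜ t = !![-θ.inf / 2, 0; 0, θ.inf / 2]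
  deriv_zero : OffDiscrete fun t => ∀ i j,
    HasDerivAt (fun r => A₀ r i j) ((Aₜ t * A₀ t - A₀ t * Aₜ t) i j / (t : ℂ)) t
  deriv_one : OffDiscrete fun t => ∀ i j,
    HasDerivAt (fun r => A₁ r i j) ((Aₜ t * A₁ t - A₁ t * Aₜ t) i j / ((t : ℂ) - 1)) t

/-- `τ` is a Jimbo–Miwa–Ueno `τ`-function of Painlevé VI with parameters `θ`: it is analytic on
`(0,1)`, and `d/dt ln τ = tr (A₀ A_t) / t + tr (A₁ A_t) / (t - 1)` for a solution of the
Schlesinger system. Its zeros are the points where this solution may have poles. -/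
def IsJMUTau (θ : Params) (τ : ℝ → ℂ) : Prop :=
  AnalyticOnNhd ℝ τ (Ioo 0 1) ∧
  ∃ A₀ A₁ Aₜ : ℝ → Matrix (Fin 2) (Fin 2) ℂ, IsSchlesingerSolution θ A₀ A₁ Aₜ ∧
    OffDiscrete fun t => τ t ≠ 0 ∧
      deriv τ t / τ t =
        (A₀ t * Aₜ t).trace / (t : ℂ) + (A₁ t * Aₜ t).trace / ((t : ℂ) - 1)

/-- The right-hand side of the sixth Painlevé equation `q'' = rhs θ t q q'`. -/
def rhs (θ : Params) (t q q' : ℂ) : ℂ :=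
  1 / 2 * (1 / q + 1 / (q - 1) + 1 / (q - t)) * q' ^ 2
    - (1 / t + 1 / (t - 1) + 1 / (q - t)) * q'
    + q * (q - 1) * (q - t) / (2 * t ^ 2 * (t - 1) ^ 2) *
      ((θ.inf - 1) ^ 2 - θ.zero ^ 2 * t / q ^ 2 + θ.one ^ 2 * (t - 1) / (q - 1) ^ 2
        + (1 - θ.t ^ 2) * t * (t - 1) / (q - t) ^ 2)

/-- `q` is a (meromorphic) solution on `(0,1)` of the sixth Painlevé equation; it is required
not to be one of the functions `0`, `1`, `t`, for which the equation has no meaning. -/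
def IsSolution (θ : Params) (q : ℝ → ℂ) : Prop :=
  MeromorphicOn q (Ioo 0 1) ∧
  OffDiscrete fun t => q t ≠ 0 ∧ q t ≠ 1 ∧ q t ≠ (t : ℂ) ∧
    deriv (deriv q) t = rhs θ t (q t) (deriv q t)

end PVI

namespace Hypergeometric

open Complex in
/-- The coefficient `κ` of the small `t` asymptotics of the `₂F₁` kernel determinant. -/
def kappa (z z' w w' : ℂ) : ℂ :=
  sin (Real.pi * z) * sin (Real.pi * z') / (Real.pi : ℂ) ^ 2 *
    (Gamma (1 + z + w) * Gamma (1 + z + w') * Gamma (1 + z' + w) * Gamma (1 + z' + w') /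
      (Gamma (2 + z + z' + w + w') * Gamma (2 + z + z' + w + w')))

/-- Admissible parameters: `z+w, z+w', z'+w, z'+w'` are not negative integers and
`Re (z+z'+w+w') > 0`. -/
def Admissible (z z' w w' : ℂ) : Prop :=
  (∀ n : ℤ, n < 0 → z + w ≠ n ∧ z + w' ≠ n ∧ z' + w ≠ n ∧ z' + w' ≠ n) ∧
  0 < (z + z' + w + w').re

/-- `D` is the `₂F₁` kernel determinant with parameters `z, z', w, w'`, defined as the
Jimbo–Miwa–Ueno `τ`-function of Painlevé VI with
`θ = (z+z'+w+w', z-z', 0, w-w')` and with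
`D t = 1 - κ t^(1+z+z'+w+w') + O(t^(2+z+z'+w+w'))` as `t → 0+`. -/
def IsTau (z z' w w' : ℂ) (D : ℝ → ℂ) : Prop :=
  PVI.IsJMUTau ⟨z + z' + w + w', z - z', 0, w - w'⟩ D ∧
  (fun t : ℝ => D t - (1 - kappa z z' w w' * (t : ℂ) ^ (1 + z + z' + w + w')))
    =O[𝓝[>] 0] (fun t : ℝ => (t : ℂ) ^ (2 + z + z' + w + w'))

end Hypergeometric

namespace PalmerBeattyTracy

/-- Parameters of the Painlevé VI transcendent that determines the Palmer–Beatty–Tracy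
`τ`-function. -/
def params (ν₁ ν₂ b : ℝ) (μ : ℂ) : PVI.Params :=
  ⟨1 + ν₁ + ν₂ - 2 * b, 0, 2 * μ, 1 + ν₁ - ν₂⟩

/-- The logarithmic derivative of the Palmer–Beatty–Tracy `τ`-function in terms of the
Painlevé VI transcendent `u` and its derivative `u'`. -/
def logDerivTau (θ : PVI.Params) (s u u' : ℂ) : ℂ :=
  s * (1 - s) / (4 * u * (1 - u) * (u - s)) * (u' - (1 - u) / (1 - s)) ^ 2
    - (1 - u) / (1 - s) *
      ((θ.inf - 1) ^ 2 / (4 * s) - (θ.zero + 1) ^ 2 / (4 * u) + θ.t ^ 2 / (4 * (u - s)))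

open Complex in
/-- The coefficient `κ_PBT` of the asymptotics of the `τ`-function as `s → 1`. -/
def kappa (ν₁ ν₂ b : ℝ) (μ : ℂ) : ℂ :=
  sin (Real.pi * ν₁) * sin (Real.pi * ν₂) / (Real.pi : ℂ) ^ 2 *
    (Gamma (2 + μ + ν₁ - b) * Gamma (μ - ν₁ + b) * Gamma (2 + μ + ν₂ - b) * Gamma (μ - ν₂ + b) /
      (Gamma (2 + 2 * μ) * Gamma (2 + 2 * μ)))

/-- `τ` is the Palmer–Beatty–Tracy `τ`-function with fluxes `ν₁, ν₂`, magnetic field parameter `b`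
and energy parameter `μ`: it is analytic on `(0,1)`, its logarithmic derivative is given
by a solution `u` of Painlevé VI, and
`τ s = 1 - κ_PBT (1-s)^(1+2μ) + O((1-s)^(2+2μ))` as `s → 1-`. -/
def IsTau (ν₁ ν₂ b : ℝ) (μ : ℂ) (τ : ℝ → ℂ) : Prop :=
  AnalyticOnNhd ℝ τ (Ioo 0 1) ∧
  (∃ u : ℝ → ℂ, PVI.IsSolution (params ν₁ ν₂ b μ) u ∧
    PVI.OffDiscrete fun s => τ s ≠ 0 ∧
      deriv τ s / τ s = logDerivTau (params ν₁ ν₂ b μ) s (u s) (deriv u s)) ∧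
  (fun s : ℝ => τ s - (1 - kappa ν₁ ν₂ b μ * ((1 - s : ℝ) : ℂ) ^ (1 + 2 * μ)))
    =O[𝓝[<] 1] (fun s : ℝ => ((1 - s : ℝ) : ℂ) ^ (2 + 2 * μ))

end PalmerBeattyTracy

end

/-! Both functions, the second read in the variable `t = 1 - s`, satisfy one and the same
third-order problem with one and the same asymptotics at `0`, and this problem has a single
solution.

The equation is the Jimbo–Miwa–Okamoto `σ`-form for `σ = t (t - 1) d/dt ln τ`. For `D` it follows
from the Schlesinger system by an identity in `𝔰𝔩₂` (`IsJMUTau.offDiscrete_sigmaForm`). For `τ_PBT`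
the logarithmic derivative is a polynomial in canonical coordinates of Painlevé VI, and the `σ`-form
follows from Hamilton's equations (`IsSolution.offDiscrete_sigmaForm`). The relations between the
parameters make the coefficients `A`, `B`, `c` equal, and with the cosine condition they make `κ`
and `κ_PBT` equal and nonzero.

Uniqueness (`eq_of_hasExpansion`) is proved in the variable `x = ln t`, as `x → -∞`, with `a = 2μ`.
The expansion bounds `ln τ` but not its derivatives; `landau_of_growth` recovers them from the
growth allowed by the `σ`-form. The `σ`-form is then differentiated and divided by `σ''`, which is
legitimate because `κ ≠ 0`. For two solutions, the difference of their `σ` satisfies a linear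
equation with exponents `0`, `1 - a`, `1 + a`, up to an error with a factor `e ^ x`. The mode `1 +
a` is the one carrying `κ`. Since the two `κ` agree, the difference decays faster than this mode,
and a contraction forces it to vanish near `0`. Analyticity extends the equality to `(0,1)`. -/

namespace PVI

/-- The `σ`-form of the sixth Painlevé equation, for `θ_t = 0`, `A = θ₀² / 4`, `B = θ₁² / 4`
and `c = A + B - θ_∞² / 4`. -/
def SigmaForm (A B c t f f₁ f₂ : ℂ) : Prop :=
  (t * (t - 1) * f₂) ^ 2 =
    -4 * (t * f₁ - f) * ((t - 1) * f₁ - f) * (f₁ + c) + 4 * A * ((t - 1) * f₁ - f) ^ 2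
      + 4 * B * (t * f₁ - f) ^ 2

/-- The function `t (t - 1) d/dt ln τ`. -/
noncomputable def sigma (τ : ℝ → ℂ) (t : ℝ) : ℂ := (t : ℂ) * (t - 1) * (deriv τ t / τ t)

/-! ### Properties that hold off a discrete subset of `(0,1)`. -/

theorem offDiscrete_iff {P : ℝ → Prop} :
    OffDiscrete P ↔ ∀ t ∈ Ioo (0 : ℝ) 1, ∀ᶠ r in 𝓝[≠] t, P r := by
  unfold OffDiscrete
  rw [Filter.Eventually, mem_codiscreteWithin]
  refine forall₂_congr fun t ht => ?_
  rw [Filter.disjoint_principal_right, Filter.Eventually]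
  constructor
  · intro h
    have h2 : Ioo (0 : ℝ) 1 ∈ 𝓝[≠] t := mem_nhdsWithin_of_mem_nhds (isOpen_Ioo.mem_nhds ht)
    filter_upwards [h, h2] with r hr hr2
    simpa [hr2] using hr
  · intro h
    filter_upwards [h] with r hr
    rw [mem_compl_iff, Set.mem_sdiff, not_and, not_not]
    exact fun _ => hr

theorem OffDiscrete.and {P Q : ℝ → Prop} (hP : OffDiscrete P) (hQ : OffDiscrete Q) :
    OffDiscrete fun t => P t ∧ Q t :=
  Filter.Eventually.and hP hQ

theorem OffDiscrete.mono {P Q : ℝ → Prop} (hP : OffDiscrete P)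
    (h : ∀ t ∈ Ioo (0 : ℝ) 1, P t → Q t) : OffDiscrete Q := by
  rw [offDiscrete_iff] at *
  intro t ht
  filter_upwards [hP t ht, mem_nhdsWithin_of_mem_nhds (isOpen_Ioo.mem_nhds ht)] with r hr hr2
  exact h r hr2 hr

/-- Turns pointwise identities into identities of germs, which can be differentiated. -/
theorem OffDiscrete.eventually_nhds {P : ℝ → Prop} (hP : OffDiscrete P) :
    OffDiscrete fun t => ∀ᶠ r in 𝓝 t, P r := by
  rw [offDiscrete_iff] at *
  intro t ht
  have h := (eventually_eventually_nhdsWithin).2 (hP t ht)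
  filter_upwards [h, self_mem_nhdsWithin] with r hr hrt
  rwa [(isOpen_compl_singleton (x := t)).nhdsWithin_eq hrt] at hr

theorem OffDiscrete.reflect {P : ℝ → Prop} (hP : OffDiscrete P) :
    OffDiscrete fun t => P (1 - t) := by
  rw [offDiscrete_iff] at *
  intro t ht
  have h := hP (1 - t) ⟨by linarith [ht.2], by linarith [ht.1]⟩
  have hc : Tendsto (fun r : ℝ => 1 - r) (𝓝[≠] t) (𝓝[≠] (1 - t)) := by
    refine tendsto_nhdsWithin_iff.2 ⟨?_, ?_⟩
    · exact ((continuous_const.sub continuous_id).tendsto t).mono_left nhdsWithin_le_nhds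
    · filter_upwards [self_mem_nhdsWithin] with r hr
      simpa using hr
  exact hc.eventually h

/-! ### From the Schlesinger system to the `σ`-form. -/

theorem hasDerivAt_trace_mul {A B : ℝ → Matrix (Fin 2) (Fin 2) ℂ}
    {A' B' : Matrix (Fin 2) (Fin 2) ℂ} {t : ℝ}
    (hA : ∀ i j, HasDerivAt (fun r => A r i j) (A' i j) t)
    (hB : ∀ i j, HasDerivAt (fun r => B r i j) (B' i j) t) :
    HasDerivAt (fun r => (A r * B r).trace) ((A' * B t).trace + (A t * B').trace) t := by
  have h : (fun r => (A r * B r).trace) =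
      fun r => A r 0 0 * B r 0 0 + A r 0 1 * B r 1 0 + (A r 1 0 * B r 0 1 + A r 1 1 * B r 1 1) := by
    funext r
    simp [Matrix.trace_fin_two, Matrix.mul_apply, Fin.sum_univ_two]
  rw [h]
  refine ((((hA 0 0).mul (hB 0 0)).add ((hA 0 1).mul (hB 1 0))).add
    (((hA 1 0).mul (hB 0 1)).add ((hA 1 1).mul (hB 1 1)))).congr_deriv ?_
  simp [Matrix.trace_fin_two, Matrix.mul_apply, Fin.sum_univ_two]
  ring

/-- For three traceless `2 × 2` matrices the square of `tr (A₀ [A_t, A₁])` is, up to a constant, the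
Gram determinant of their pairwise traces. The traces of squares are given by the exponents, `tr (A₀
A₁)` by the square of the sum, and the two remaining traces are linear in `f` and `f₁`. In entries
it is a polynomial identity modulo `det A_t = 0`, which is `hd`. -/
theorem sigmaForm_of_hasExponent {θ : Params} {A₀ A₁ Aₜ : Matrix (Fin 2) (Fin 2) ℂ} {t : ℂ}
    (h₀ : HasExponent A₀ θ.zero) (h₁ : HasExponent A₁ θ.one) (hₜ : HasExponent Aₜ 0)
    (hs : A₀ + A₁ + Aₜ = !![-θ.inf / 2, 0; 0, θ.inf / 2]) {f f₁ f₂ : ℂ}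
    (hf : f = (t - 1) * (A₀ * Aₜ).trace + t * (A₁ * Aₜ).trace)
    (hf₁ : f₁ = (A₀ * Aₜ).trace + (A₁ * Aₜ).trace)
    (hf₂ : t * (t - 1) * f₂ = -(A₀ * (Aₜ * A₁ - A₁ * Aₜ)).trace) :
    SigmaForm (θ.zero ^ 2 / 4) (θ.one ^ 2 / 4)
      (θ.zero ^ 2 / 4 + θ.one ^ 2 / 4 - θ.inf ^ 2 / 4) t f f₁ f₂ := by
  obtain ⟨h₀t, h₀d⟩ := h₀
  obtain ⟨h₁t, h₁d⟩ := h₁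
  obtain ⟨hₜt, hₜd⟩ := hₜ
  have e := fun i j => congrFun (congrFun hs i) j
  have e00 := e 0 0
  have e01 := e 0 1
  have e10 := e 1 0
  simp only [Matrix.add_apply, Matrix.of_apply, Matrix.cons_val', Matrix.cons_val_zero,
    Matrix.cons_val_one, Matrix.cons_val_fin_one] at e00 e01 e10
  rw [Matrix.trace_fin_two] at h₀t h₁t hₜt
  rw [Matrix.det_fin_two] at h₀d h₁d hₜd
  unfold SigmaForm
  rw [hf₂, hf, hf₁]
  simp only [Matrix.trace_fin_two, Matrix.mul_apply, Fin.sum_univ_two, Matrix.sub_apply]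
  have z0 : θ.zero ^ 2 / 4 = A₀ 0 0 ^ 2 + A₀ 0 1 * A₀ 1 0 := by
    linear_combination h₀d - A₀ 0 0 * h₀t
  have z1 : θ.one ^ 2 / 4 = A₁ 0 0 ^ 2 + A₁ 0 1 * A₁ 1 0 := by
    linear_combination h₁d - A₁ 0 0 * h₁t
  have zi : θ.inf ^ 2 / 4 = (A₀ 0 0 + A₁ 0 0 + Aₜ 0 0) ^ 2 := by
    rw [e00]; ring
  rw [z0, z1, zi]
  have f0 : A₀ 1 1 = -A₀ 0 0 := by linear_combination h₀t
  have f1 : A₁ 1 1 = -A₁ 0 0 := by linear_combination h₁t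
  have ft : Aₜ 1 1 = -Aₜ 0 0 := by linear_combination hₜt
  have g01 : A₀ 0 1 = -A₁ 0 1 - Aₜ 0 1 := by linear_combination e01
  have g10 : A₀ 1 0 = -A₁ 1 0 - Aₜ 1 0 := by linear_combination e10
  rw [ft] at hₜd
  rw [f0, f1, ft, g01, g10]
  generalize A₀ 0 0 = a at *
  generalize A₁ 0 0 = b at *
  generalize Aₜ 0 0 = d at *
  generalize A₁ 0 1 = b1 at *
  generalize A₁ 1 0 = b2 at *
  generalize Aₜ 0 1 = d1 at *
  generalize Aₜ 1 0 = d2 at *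
  have hd : d ^ 2 + d1 * d2 = 0 := by linear_combination -hₜd
  linear_combination (4 * (2 * a * d + (-b1 - d1) * d2 + (-b2 - d2) * d1) *
      (2 * b * d + b1 * d2 + b2 * d1)
    + 4 * (2 * a * d + (-b1 - d1) * d2 + (-b2 - d2) * d1 + (2 * b * d + b1 * d2 + b2 * d1)
      + (a ^ 2 + (-b1 - d1) * (-b2 - d2)) + (b ^ 2 + b1 * b2) - (a + b + d) ^ 2
      + (d ^ 2 + d1 * d2)) ^ 2
    - 16 * (a ^ 2 + (-b1 - d1) * (-b2 - d2)) * (b ^ 2 + b1 * b2)) * hd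

theorem IsJMUTau.offDiscrete_sigmaForm {θ : Params} (hθ : θ.t = 0) {τ : ℝ → ℂ}
    (h : IsJMUTau θ τ) :
    OffDiscrete fun t => τ t ≠ 0 ∧ SigmaForm (θ.zero ^ 2 / 4) (θ.one ^ 2 / 4)
      (θ.zero ^ 2 / 4 + θ.one ^ 2 / 4 - θ.inf ^ 2 / 4) t
      (sigma τ t) (deriv (sigma τ) t) (deriv (deriv (sigma τ)) t) := by
  obtain ⟨-, A₀, A₁, Aₜ, hS, hL⟩ := h
  have hsum := hS.sum_eq.eventually_nhds
  have hσ : OffDiscrete fun t => sigma τ t =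
      (t - 1) * (A₀ t * Aₜ t).trace + t * (A₁ t * Aₜ t).trace := by
    refine hL.mono fun t ht h => ?_
    have h0 : (t : ℂ) ≠ 0 := by exact_mod_cast ht.1.ne'
    have h1 : (t : ℂ) - 1 ≠ 0 := sub_ne_zero.2 (by exact_mod_cast ht.2.ne)
    rw [sigma, h.2]
    field_simp
  have hd := ((hS.deriv_zero.and hS.deriv_one).and hsum).mono (Q := fun t =>
      HasDerivAt (fun r => (A₀ r * Aₜ r).trace)
        (-(A₀ t * (Aₜ t * A₁ t - A₁ t * Aₜ t)).trace / (t - 1)) t ∧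
      HasDerivAt (fun r => (A₁ r * Aₜ r).trace)
        ((A₀ t * (Aₜ t * A₁ t - A₁ t * Aₜ t)).trace / t) t) (by
    rintro t ht ⟨⟨h₀, h₁⟩, hs⟩
    -- The derivative of `A_t` comes from the constancy of `A₀ + A₁ + A_t`.
    have hA : ∀ i j, HasDerivAt (fun r => Aₜ r i j)
        (-((Aₜ t * A₀ t - A₀ t * Aₜ t) i j / (t : ℂ)
          + (Aₜ t * A₁ t - A₁ t * Aₜ t) i j / ((t : ℂ) - 1))) t := by
      intro i j
      have h := ((hasDerivAt_const t
        ((!![-θ.inf / 2, 0; 0, θ.inf / 2] : Matrix (Fin 2) (Fin 2) ℂ) i j)).sub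
          ((h₀ i j).add (h₁ i j))).congr_of_eventuallyEq (f₁ := fun r => Aₜ r i j) (by
        filter_upwards [hs] with r hr
        rw [← hr]
        simp [Matrix.add_apply])
      simpa using h
    have e₀ := hasDerivAt_trace_mul (A := A₀) (B := Aₜ)
      (A' := Matrix.of fun i j => (Aₜ t * A₀ t - A₀ t * Aₜ t) i j / (t : ℂ))
      (B' := Matrix.of fun i j => -((Aₜ t * A₀ t - A₀ t * Aₜ t) i j / (t : ℂ)
          + (Aₜ t * A₁ t - A₁ t * Aₜ t) i j / ((t : ℂ) - 1))) h₀ hA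
    have e₁ := hasDerivAt_trace_mul (A := A₁) (B := Aₜ)
      (A' := Matrix.of fun i j => (Aₜ t * A₁ t - A₁ t * Aₜ t) i j / ((t : ℂ) - 1))
      (B' := Matrix.of fun i j => -((Aₜ t * A₀ t - A₀ t * Aₜ t) i j / (t : ℂ)
          + (Aₜ t * A₁ t - A₁ t * Aₜ t) i j / ((t : ℂ) - 1))) h₁ hA
    have h0 : (t : ℂ) ≠ 0 := by exact_mod_cast ht.1.ne'
    have h1 : (t : ℂ) - 1 ≠ 0 := sub_ne_zero.2 (by exact_mod_cast ht.2.ne)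
    refine ⟨e₀.congr_deriv ?_, e₁.congr_deriv ?_⟩ <;>
    · simp only [Matrix.trace_fin_two, Matrix.mul_apply, Fin.sum_univ_two, Matrix.sub_apply,
        Matrix.of_apply]
      field_simp
      ring)
  -- The derivatives of the two traces, weighted by `t - 1` and `t`, cancel.
  have hd1 : OffDiscrete fun t => deriv (sigma τ) t =
      (A₀ t * Aₜ t).trace + (A₁ t * Aₜ t).trace := by
    refine (hσ.eventually_nhds.and hd).mono ?_
    rintro t ht ⟨hs, e₀, e₁⟩
    have h0 : (t : ℂ) ≠ 0 := by exact_mod_cast ht.1.ne'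
    have h1 : (t : ℂ) - 1 ≠ 0 := sub_ne_zero.2 (by exact_mod_cast ht.2.ne)
    have hid : HasDerivAt (fun r : ℝ => (r : ℂ)) 1 t := Complex.ofRealCLM.hasDerivAt
    have := (((hid.sub_const 1).mul e₀).add (hid.mul e₁)).congr_of_eventuallyEq (f₁ := sigma τ) hs
    rw [this.deriv]
    field_simp
    ring
  refine (((hL.and hσ).and (hd1.eventually_nhds.and hd)).and
    (hS.exponents.and hS.sum_eq)).mono ?_
  rintro t ht ⟨⟨⟨⟨hn, -⟩, hs⟩, ⟨hs1, e₀, e₁⟩⟩, ⟨⟨x0, x1, xt⟩, hsum⟩⟩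
  have h0 : (t : ℂ) ≠ 0 := by exact_mod_cast ht.1.ne'
  have h1 : (t : ℂ) - 1 ≠ 0 := sub_ne_zero.2 (by exact_mod_cast ht.2.ne)
  rw [hθ] at xt
  refine ⟨hn, sigmaForm_of_hasExponent x0 x1 xt hsum hs hs1.self_of_nhds ?_⟩
  have := (e₀.add e₁).congr_of_eventuallyEq (f₁ := deriv (sigma τ)) hs1
  rw [this.deriv]
  field_simp
  ring

end PVI

/-! ### From the Palmer–Beatty–Tracy formula to the `σ`-form. -/

namespace PVI

/-- In canonical coordinates `(u, y)`, the second derivative of the Hamiltonian function of the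
sixth Painlevé equation with `θ₁ = 0` satisfies the `σ`-form. -/
theorem sigmaForm_hamiltonian {s u y u' y' α γ B g g₁ g₂ : ℂ} (hs1 : s - 1 ≠ 0)
    (hu' : s * (s - 1) * u' =
      s * (u - 1) + 2 * (u - 1) * (u * (u - s) * y + γ * (u - s) + α * u))
    (hy' : s * (s - 1) * y' = -(u * (u - s) * y ^ 2 + 2 * (γ * (u - s) + α * u) * y
      + ((γ + α) ^ 2 - B) + (u - 1) * ((2 * u - s) * y ^ 2 + 2 * (γ + α) * y)) - s * y)
    (hg : g = (u - 1) * (u * (u - s) * y ^ 2 + 2 * (γ * (u - s) + α * u) * y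
      + ((γ + α) ^ 2 - B)))
    (hg₁ : g₁ = (u - 1) / (s - 1) * ((u - 1) * (u - s) * y ^ 2
      + 2 * (γ * (u - s) + α * (u - 1)) * y + ((γ + α) ^ 2 - B)))
    (hg₂ : g₂ = (u' * (s - 1) - (u - 1)) / (s - 1) ^ 2 * ((u - 1) * (u - s) * y ^ 2
      + 2 * (γ * (u - s) + α * (u - 1)) * y + ((γ + α) ^ 2 - B))
      + (u - 1) / (s - 1) * ((u' * (u - s) + (u - 1) * (u' - 1)) * y ^ 2
        + (u - 1) * (u - s) * (2 * y * y') + 2 * (γ * (u' - 1) + α * u') * y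
        + 2 * (γ * (u - s) + α * (u - 1)) * y')) :
    SigmaForm (α ^ 2) B (α ^ 2 + B - γ ^ 2) (1 - s) (-g) g₁ (-g₂) := by
  -- In the variables `n` and `w = (s - 1) y` everything becomes polynomial, and the linear forms in
  -- `g` and `g₁` that occur in the `σ`-form factor.
  set n := (u - 1) / (s - 1) with hn
  have hun : u = n * (s - 1) + 1 := by rw [hn]; field_simp; ring
  have hX : s * g₁ - g = n * (((u - s) * y + γ + α) ^ 2 - B) := by
    rw [hg₁, hg, hun]; ring
  have hY : (s - 1) * g₁ - g = -(n * (s - 1)) * y * ((u - s) * y + 2 * α) := by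
    rw [hg₁, hg, hun]; ring
  have hun1 : u - 1 = n * (s - 1) := by rw [hun]; ring
  have hW : s * (s - 1) * g₂ =
      2 * n * (u * (u - s) * y + γ * (u - s) + α * u) * ((u - 1) * (u - s) * y ^ 2
        + 2 * (γ * (u - s) + α * (u - 1)) * y + ((γ + α) ^ 2 - B))
      + n * ((s * (s - 1) * u' * (u - s) + (u - 1) * (s * (s - 1) * u' - s * (s - 1))) * y ^ 2
        + (u - 1) * (u - s) * (2 * y * (s * (s - 1) * y'))
        + 2 * (γ * (s * (s - 1) * u' - s * (s - 1)) + α * (s * (s - 1) * u')) * y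
        + 2 * (γ * (u - s) + α * (u - 1)) * (s * (s - 1) * y')) := by
    have h1 : s * (s - 1) * ((u' * (s - 1) - (u - 1)) / (s - 1) ^ 2) =
        2 * n * (u * (u - s) * y + γ * (u - s) + α * u) := by
      rw [hn]
      field_simp
      linear_combination hu'
    rw [hg₂, ← h1]
    ring
  set w := (s - 1) * y with hw
  have hk : (u - s) * y = (n - 1) * w := by rw [hun, hw]; ring
  set N := u * ((n - 1) * w) + γ * ((n - 1) * (s - 1)) + α * u with hN
  set e := (γ + α) ^ 2 - B with he
  have hU : s * (s - 1) * u' = (s - 1) * (n * (s + 2 * N)) := by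
    rw [hu', hN, hw, hun]; ring
  set V := -(u * (n - 1) * w ^ 2 + 2 * (γ * ((n - 1) * (s - 1)) + α * u) * w + (s - 1) * e
    + n * ((2 * u - s) * w ^ 2 + 2 * (γ + α) * (s - 1) * w)) - s * w with hV
  have hV' : (s - 1) * (s * (s - 1) * y') = V := by
    rw [hy', hV, hw, hun]; ring
  have hG : (u - 1) * (u - s) * y ^ 2 + 2 * (γ * (u - s) + α * (u - 1)) * y + e =
      n * (n - 1) * w ^ 2 + 2 * (γ * (n - 1) + α * n) * w + e := by
    rw [hw, hun]; ring
  have hN' : u * (u - s) * y + γ * (u - s) + α * u = N := by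
    rw [hN, hw, hun]; ring
  rw [hG, hN', hU] at hW
  rw [hG] at hg₁
  have hus : u - s = (n - 1) * (s - 1) := by rw [hun]; ring
  rw [hun1, hus] at hW
  have hW' : s * (s - 1) * g₂ = 2 * (((n - 1) * w + α) * g₁
      + γ * (n * w * ((n - 1) * w + 2 * α))) := by
    have h2 : s * (s - 1) * g₂ = n * (2 * N * (n * (n - 1) * w ^ 2
          + 2 * (γ * (n - 1) + α * n) * w + e)
        + (n * (s + 2 * N) * (2 * n - 1) - n * s) * w ^ 2
        + 2 * (γ * (n * (s + 2 * N) - s) + α * (n * (s + 2 * N))) * w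
        + 2 * (n * (n - 1) * w + γ * (n - 1) + α * n) * V) := by
      rw [← hV', hW, hw]
      ring
    rw [h2, hg₁, hV, hN, hun]
    ring
  rw [hk] at hX
  replace hY : (s - 1) * g₁ - g = -(n * w * ((n - 1) * w + 2 * α)) := by
    rw [hY, hk, hw]; ring
  have hZ : g₁ = n * (((n - 1) * w + γ + α) ^ 2 - B) + n * w * ((n - 1) * w + 2 * α) := by
    linear_combination hX - hY
  unfold SigmaForm
  have e0 : ((1 - s) * (1 - s - 1) * -g₂) ^ 2 = (s * (s - 1) * g₂) ^ 2 := by ring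
  have e1 : (1 - s) * g₁ - -g = -((s - 1) * g₁ - g) := by ring
  have e2 : (1 - s - 1) * g₁ - -g = -(s * g₁ - g) := by ring
  rw [e0, e1, e2, hX, hY, hW', hZ]
  -- What remains is to expand `(κ R + p S) ^ 2`, using these values of `κ ^ 2`, `p ^ 2` and `2 κ
  -- p`.
  have hκ : ((n - 1) * w + α) ^ 2 = α ^ 2 + (n - 1) * (w * ((n - 1) * w + 2 * α)) := by ring
  have hp : ((n - 1) * w + γ + α) ^ 2 = ((n - 1) * w + γ + α) ^ 2 - B + B := by ring
  have hκp : 2 * ((n - 1) * w + α) * ((n - 1) * w + γ + α) =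
      ((n - 1) * w + α) ^ 2 + ((n - 1) * w + γ + α) ^ 2 - γ ^ 2 := by ring
  have hγ : γ = ((n - 1) * w + γ + α) - ((n - 1) * w + α) := by ring
  have hY' : n * w * ((n - 1) * w + 2 * α) = n * (w * ((n - 1) * w + 2 * α)) := by ring
  rw [hY']
  generalize w * ((n - 1) * w + 2 * α) = S at *
  generalize hR : ((n - 1) * w + γ + α) ^ 2 - B = R at *
  generalize (n - 1) * w + γ + α = p at *
  generalize (n - 1) * w + α = κ at *
  have hγ' : κ * (n * R + n * S) + γ * (n * S) = n * (κ * R + p * S) := by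
    rw [hγ]; ring
  rw [hγ']
  linear_combination 4 * n ^ 2 * ((R ^ 2 + R * S) * hκ + (S ^ 2 + R * S) * hp + R * S * hκp)

end PVI

namespace PVI

/-- The momentum conjugate to a solution `u` of the sixth Painlevé equation with `θ₁ = 0`. -/
noncomputable def momentum (α γ s u u' : ℂ) : ℂ :=
  s * (s - 1) * (u' - (u - 1) / (s - 1)) / (2 * u * (u - 1) * (u - s)) - γ / u - α / (u - s)

/-- `momentum` is this equation solved for `y`. It is the first of Hamilton's equations for `(g + s
(u - 1) y) / (s (s - 1))`, where `g` is the polynomial of `sigmaForm_hamiltonian`. -/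
theorem momentum_fst {α γ s u u' : ℂ} (hs1 : s - 1 ≠ 0) (hu : u ≠ 0)
    (hu1 : u - 1 ≠ 0) (hus : u - s ≠ 0) :
    s * (s - 1) * u' = s * (u - 1) +
      2 * (u - 1) * (u * (u - s) * momentum α γ s u u' + γ * (u - s) + α * u) := by
  unfold momentum
  field_simp
  ring

/-- The squared bracket of `logDerivTau` is linear in the momentum, so the formula is the completed
square of the quadratic polynomial `g`. -/
theorem momentum_logDerivTau {θ : Params} {s u u' : ℂ} (hs : s ≠ 0) (hs1 : s - 1 ≠ 0)
    (hu : u ≠ 0) (hu1 : u - 1 ≠ 0) (hus : u - s ≠ 0) :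
    s * (s - 1) * PalmerBeattyTracy.logDerivTau θ s u u' =
      (u - 1) * (u * (u - s) * momentum (θ.t / 2) ((θ.zero + 1) / 2) s u u' ^ 2
        + 2 * ((θ.zero + 1) / 2 * (u - s) + θ.t / 2 * u)
          * momentum (θ.t / 2) ((θ.zero + 1) / 2) s u u'
        + (((θ.zero + 1) / 2 + θ.t / 2) ^ 2 - ((θ.inf - 1) / 2) ^ 2)) := by
  have hs1' : 1 - s ≠ 0 := by rwa [← neg_sub, neg_ne_zero]
  have hu1' : 1 - u ≠ 0 := by rwa [← neg_sub, neg_ne_zero]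
  obtain ⟨w, hw⟩ : ∃ w, w = u' - (u - 1) / (s - 1) := ⟨_, rfl⟩
  have hw' : u' - (1 - u) / (1 - s) = w := by
    rw [hw, ← neg_sub u 1, ← neg_sub s 1, neg_div_neg_eq]
  unfold PalmerBeattyTracy.logDerivTau momentum
  rw [hw', ← hw, ← neg_sub u 1, ← neg_sub s 1]
  field_simp
  ring

/-- Painlevé VI, written for the momentum, is the second of Hamilton's equations. -/
theorem hasDerivAt_momentum {θ : Params} (h1 : θ.one = 0) {u u' : ℝ → ℂ} {s : ℝ}
    (hs : (s : ℂ) ≠ 0) (hs1 : (s : ℂ) - 1 ≠ 0)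
    (hu : u s ≠ 0) (hu1 : u s - 1 ≠ 0) (hus : u s - s ≠ 0)
    (hd : HasDerivAt u (u' s) s) (hd' : HasDerivAt u' (rhs θ s (u s) (u' s)) s)
    {y y' : ℂ} (hy : y = momentum (θ.t / 2) ((θ.zero + 1) / 2) s (u s) (u' s))
    (hy' : s * (s - 1) * y' = -(u s * (u s - s) * y ^ 2
      + 2 * ((θ.zero + 1) / 2 * (u s - s) + θ.t / 2 * u s) * y
      + (((θ.zero + 1) / 2 + θ.t / 2) ^ 2 - ((θ.inf - 1) / 2) ^ 2)
      + (u s - 1) * ((2 * u s - s) * y ^ 2 + 2 * ((θ.zero + 1) / 2 + θ.t / 2) * y)) - s * y) :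
    HasDerivAt (fun r : ℝ => momentum (θ.t / 2) ((θ.zero + 1) / 2) r (u r) (u' r)) y' s := by
  have hid : HasDerivAt (fun r : ℝ => (r : ℂ)) 1 s := Complex.ofRealCLM.hasDerivAt
  have hn : HasDerivAt (fun r : ℝ => (r : ℂ) * (r - 1) * (u' r - (u r - 1) / (r - 1)))
      ((2 * s - 1) * (u' s - (u s - 1) / (s - 1)) + s * (s - 1) * (rhs θ s (u s) (u' s)
        - (u' s * (s - 1) - (u s - 1)) / (s - 1) ^ 2)) s := by
    refine ((hid.mul (hid.sub_const 1)).mul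
      (hd'.sub ((hd.sub_const 1).div (hid.sub_const 1) hs1))).congr_deriv ?_
    simp only [Pi.mul_apply, Pi.sub_apply, Pi.div_apply]
    ring
  have hden : HasDerivAt (fun r : ℝ => 2 * u r * (u r - 1) * (u r - r))
      (2 * (u' s * (u s - 1) + u s * u' s) * (u s - s)
        + 2 * u s * (u s - 1) * (u' s - 1)) s := by
    refine (((hd.const_mul 2).mul (hd.sub_const 1)).mul (hd.sub hid)).congr_deriv ?_
    simp only [Pi.mul_apply, Pi.sub_apply]
    ring
  have hm := ((hn.div hden (mul_ne_zero (mul_ne_zero (mul_ne_zero two_ne_zero hu) hu1) hus)).sub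
    ((hasDerivAt_const s ((θ.zero + 1) / 2)).div hd hu)).sub
    ((hasDerivAt_const s (θ.t / 2)).div (hd.sub hid) hus)
  refine HasDerivAt.congr_deriv hm ?_
  refine mul_left_cancel₀ (mul_ne_zero hs hs1) ?_
  rw [hy', hy]
  obtain ⟨w, hw⟩ : ∃ w, w = u' s - (u s - 1) / (s - 1) := ⟨_, rfl⟩
  have hw' : u' s = w + (u s - 1) / (s - 1) := by rw [hw]; ring
  unfold momentum rhs
  simp only [Pi.sub_apply, h1]
  generalize u s = q at *
  generalize u' s = q' at *
  generalize (s : ℂ) = s at *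
  have hsq : s - q ≠ 0 := by rwa [← neg_sub, neg_ne_zero]
  field_simp
  ring

theorem sigma_reflect (τ : ℝ → ℂ) :
    sigma (fun t => τ (1 - t)) = fun t => -sigma τ (1 - t) := by
  funext t
  unfold sigma
  rw [deriv_comp_const_sub]
  push_cast
  ring

/-- After the reflection, the parameters `θ_t`, `θ_∞ - 1`, `θ₀ + 1` of `u` take the places that
`θ₀`, `θ₁`, `θ_∞` have in the `σ`-form of the Schlesinger system. -/
theorem IsSolution.offDiscrete_sigmaForm {θ : Params} (h1 : θ.one = 0) {u τ : ℝ → ℂ}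
    (hu : IsSolution θ u)
    (hτ : OffDiscrete fun s => τ s ≠ 0 ∧
      deriv τ s / τ s = PalmerBeattyTracy.logDerivTau θ s (u s) (deriv u s)) :
    OffDiscrete fun t => τ (1 - t) ≠ 0 ∧ SigmaForm ((θ.t / 2) ^ 2) (((θ.inf - 1) / 2) ^ 2)
      ((θ.t / 2) ^ 2 + ((θ.inf - 1) / 2) ^ 2 - ((θ.zero + 1) / 2) ^ 2) t
      (sigma (fun t => τ (1 - t)) t) (deriv (sigma fun t => τ (1 - t)) t)
      (deriv (deriv (sigma fun t => τ (1 - t))) t) := by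
  set α := θ.t / 2 with hα
  set γ := (θ.zero + 1) / 2 with hγ
  set B := ((θ.inf - 1) / 2) ^ 2 with hB
  set y : ℝ → ℂ := fun s => momentum α γ s (u s) (deriv u s) with hy
  obtain ⟨hmero, hsol⟩ := hu
  have hana : OffDiscrete fun s => AnalyticAt ℝ u s := hmero.analyticAt_mem_codiscreteWithin
  have hne : ∀ s ∈ Ioo (0 : ℝ) 1, (s : ℂ) ≠ 0 ∧ (s : ℂ) - 1 ≠ 0 := fun s hs =>
    ⟨by exact_mod_cast hs.1.ne', sub_ne_zero.2 (by exact_mod_cast hs.2.ne)⟩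
  have hid : ∀ s : ℝ, HasDerivAt (fun r : ℝ => (r : ℂ)) 1 s := fun s =>
    Complex.ofRealCLM.hasDerivAt
  have hσ : OffDiscrete fun s => sigma τ s = (u s - 1) * (u s * (u s - s) * y s ^ 2
      + 2 * (γ * (u s - s) + α * u s) * y s + ((γ + α) ^ 2 - B)) := by
    refine (hsol.and hτ).mono ?_
    rintro s hs ⟨⟨hu, hu1, hus, -⟩, -, hL⟩
    rw [sigma, hL, momentum_logDerivTau (hne s hs).1 (hne s hs).2 hu (sub_ne_zero.2 hu1)
      (sub_ne_zero.2 hus)]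
  have hd : OffDiscrete fun s => ∃ u' y' : ℂ, HasDerivAt u u' s ∧ HasDerivAt y y' s ∧
      s * (s - 1) * u' =
        s * (u s - 1) + 2 * (u s - 1) * (u s * (u s - s) * y s + γ * (u s - s) + α * u s) ∧
      s * (s - 1) * y' = -(u s * (u s - s) * y s ^ 2 + 2 * (γ * (u s - s) + α * u s) * y s
        + ((γ + α) ^ 2 - B) + (u s - 1) * ((2 * u s - s) * y s ^ 2 + 2 * (γ + α) * y s))
        - s * y s := by
    refine (hana.and hsol).mono ?_
    rintro s hs ⟨ha, hu, hu1, hus, hode⟩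
    obtain ⟨hs0, hs1⟩ := hne s hs
    have hmul : (s : ℂ) * (s - 1) ≠ 0 := mul_ne_zero hs0 hs1
    obtain ⟨y', hy'⟩ : ∃ y' : ℂ, s * (s - 1) * y' =
        -(u s * (u s - s) * y s ^ 2 + 2 * (γ * (u s - s) + α * u s) * y s
        + ((γ + α) ^ 2 - B) + (u s - 1) * ((2 * u s - s) * y s ^ 2 + 2 * (γ + α) * y s))
        - s * y s := ⟨_ / (s * (s - 1)), mul_div_cancel₀ _ hmul⟩
    have hdd : HasDerivAt (deriv u) (rhs θ s (u s) (deriv u s)) s := by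
      rw [← hode]
      exact ha.deriv.differentiableAt.hasDerivAt
    exact ⟨deriv u s, y', ha.differentiableAt.hasDerivAt,
      hasDerivAt_momentum h1 hs0 hs1 hu (sub_ne_zero.2 hu1) (sub_ne_zero.2 hus)
        ha.differentiableAt.hasDerivAt hdd rfl hy',
      momentum_fst hs1 hu (sub_ne_zero.2 hu1) (sub_ne_zero.2 hus), hy'⟩
  have hσ₁ : OffDiscrete fun s => deriv (sigma τ) s = (u s - 1) / (s - 1)
      * ((u s - 1) * (u s - s) * y s ^ 2 + 2 * (γ * (u s - s) + α * (u s - 1)) * y s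
        + ((γ + α) ^ 2 - B)) := by
    refine (hσ.eventually_nhds.and hd).mono ?_
    rintro s hs ⟨he, u', y', hu', hy', e₁, e₂⟩
    obtain ⟨hs0, hs1⟩ := hne s hs
    have h := ((hu'.sub_const 1).mul ((((hu'.mul (hu'.sub (hid s))).mul (hy'.pow 2)).add
      (((((hu'.sub (hid s)).const_mul γ).add (hu'.const_mul α)).const_mul 2).mul hy')).add_const
        ((γ + α) ^ 2 - B))).congr_of_eventuallyEq (f₁ := sigma τ) he
    rw [h.deriv]
    refine mul_left_cancel₀ (mul_ne_zero (mul_ne_zero hs0 hs1) hs1) ?_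
    simp only [Pi.mul_apply, Pi.sub_apply, Pi.add_apply, Pi.pow_apply]
    generalize u s = q at *
    generalize y s = p at *
    generalize (s : ℂ) = s at *
    set G := q * (q - s) * p ^ 2 + 2 * (γ * (q - s) + α * q) * p + ((γ + α) ^ 2 - B) with hG
    have e : s * (s - 1) * (s - 1) * ((q - 1) / (s - 1) * ((q - 1) * (q - s) * p ^ 2
        + 2 * (γ * (q - s) + α * (q - 1)) * p + ((γ + α) ^ 2 - B))) =
        s * (s - 1) * ((q - 1) * ((q - 1) * (q - s) * p ^ 2
        + 2 * (γ * (q - s) + α * (q - 1)) * p + ((γ + α) ^ 2 - B))) := by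
      field_simp
    rw [e]
    linear_combination (s - 1) * (G + (q - 1) * ((2 * q - s) * p ^ 2 + 2 * (γ + α) * p)) * e₁
      + (s - 1) * (q - 1) * (2 * q * (q - s) * p + 2 * (γ * (q - s) + α * q)) * e₂
  have hmain := (hτ.and hσ).and (hσ₁.and (hσ₁.eventually_nhds.and hd))
  refine hmain.reflect.mono ?_
  rintro t ht ⟨⟨⟨hn, -⟩, hσt⟩, hσ₁t, he, u', y', hu', hy', e₁, e₂⟩
  refine ⟨hn, ?_⟩
  rw [sigma_reflect]
  have hder : deriv (fun t => -sigma τ (1 - t)) = fun t => deriv (sigma τ) (1 - t) := by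
    funext t
    rw [deriv.fun_neg, deriv_comp_const_sub, neg_neg]
  rw [hder, deriv_comp_const_sub]
  obtain ⟨hs0, hs1⟩ := hne (1 - t) ⟨by linarith [ht.2], by linarith [ht.1]⟩
  have h := (((hu'.sub_const 1).div ((hid _).sub_const 1) hs1).mul
    (((((hu'.sub_const 1).mul (hu'.sub (hid _))).mul (hy'.pow 2)).add
      (((((hu'.sub (hid _)).const_mul γ).add ((hu'.sub_const 1).const_mul α)).const_mul 2).mul
        hy')).add_const ((γ + α) ^ 2 - B))).congr_of_eventuallyEq (f₁ := deriv (sigma τ)) he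
  have hfin := sigmaForm_hamiltonian (g₂ := deriv (deriv (sigma τ)) (1 - t)) hs1 e₁ e₂ hσt hσ₁t (by
    rw [h.deriv]
    simp only [Pi.mul_apply, Pi.sub_apply, Pi.add_apply, Pi.pow_apply, Pi.div_apply]
    ring)
  have ht1 : 1 - (((1 - t : ℝ)) : ℂ) = t := by push_cast; ring
  rwa [ht1] at hfin

end PVI

/-! ### Differentiation of the `σ`-form. -/

namespace PVI

/-- The equation obtained from the `σ`-form by differentiation and division by `2 f''`. -/
def SigmaFormDeriv (A B c t f f₁ f₂ f₃ : ℂ) : Prop :=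
  t ^ 2 * (t - 1) ^ 2 * f₃ + t * (t - 1) * (2 * t - 1) * f₂ =
    t * (-2 * ((t - 1) * f₁ - f) * (f₁ + c) + 4 * B * (t * f₁ - f))
      + (t - 1) * (-2 * (t * f₁ - f) * (f₁ + c) + 4 * A * ((t - 1) * f₁ - f))
      - 2 * (t * f₁ - f) * ((t - 1) * f₁ - f)

theorem analyticOnNhd_sigma {τ : ℝ → ℂ} (hτ : AnalyticOnNhd ℝ τ (Ioo 0 1)) {ε : ℝ} (hε : ε ≤ 1)
    (h0 : ∀ t ∈ Ioo 0 ε, τ t ≠ 0) : AnalyticOnNhd ℝ (sigma τ) (Ioo 0 ε) := by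
  intro t ht
  have ha := hτ t ⟨ht.1, ht.2.trans_le hε⟩
  have hid : AnalyticAt ℝ (fun r : ℝ => (r : ℂ)) t := Complex.ofRealCLM.analyticAt t
  exact (hid.mul (hid.sub analyticAt_const)).mul (ha.deriv.div ha (h0 t ht))

theorem sigmaForm_of_offDiscrete {f : ℝ → ℂ} {A B c : ℂ} {ε : ℝ} (hε : ε ≤ 1)
    (hf : AnalyticOnNhd ℝ f (Ioo 0 ε))
    (h : OffDiscrete fun t => SigmaForm A B c t (f t) (deriv f t) (deriv (deriv f) t)) :
    ∀ t ∈ Ioo 0 ε, SigmaForm A B c t (f t) (deriv f t) (deriv (deriv f) t) := by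
  intro t ht
  have h0 := (hf t ht).continuousAt
  have h1 := (hf t ht).deriv.continuousAt
  have h2 := (hf t ht).deriv.deriv.continuousAt
  have hev := offDiscrete_iff.1 h t ⟨ht.1, ht.2.trans_le hε⟩
  unfold SigmaForm at *
  have hid : ContinuousAt (fun r : ℝ => (r : ℂ)) t := Complex.continuous_ofReal.continuousAt
  have hl : ContinuousAt (fun r : ℝ => ((r : ℂ) * (r - 1) * deriv (deriv f) r) ^ 2) t := by
    fun_prop
  have hr : ContinuousAt (fun r : ℝ => -4 * ((r : ℂ) * deriv f r - f r) * ((r - 1) * deriv f r - f r)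
      * (deriv f r + c) + 4 * A * ((r - 1) * deriv f r - f r) ^ 2
      + 4 * B * (r * deriv f r - f r) ^ 2) t := by
    fun_prop
  exact tendsto_nhds_unique_of_eventuallyEq (hl.tendsto.mono_left nhdsWithin_le_nhds)
    (hr.tendsto.mono_left nhdsWithin_le_nhds) hev

/-- The derivative of the `σ`-form has `f''` as a factor, and analytic functions on an interval have
no zero divisors. The first alternative covers the affine solutions, for which the division is not
allowed. -/
theorem sigmaFormDeriv_or {f : ℝ → ℂ} {A B c : ℂ} {ε : ℝ}
    (hf : AnalyticOnNhd ℝ f (Ioo 0 ε))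
    (h : ∀ t ∈ Ioo 0 ε, SigmaForm A B c t (f t) (deriv f t) (deriv (deriv f) t)) :
    (∀ t ∈ Ioo 0 ε, deriv (deriv f) t = 0) ∨
      ∀ t ∈ Ioo 0 ε, SigmaFormDeriv A B c t (f t) (deriv f t) (deriv (deriv f) t)
        (deriv (deriv (deriv f)) t) := by
  have hid : AnalyticOnNhd ℝ (fun r : ℝ => (r : ℂ)) (Ioo 0 ε) := fun t _ =>
    Complex.ofRealCLM.analyticAt t
  have hid' : ∀ t : ℝ, HasDerivAt (fun r : ℝ => (r : ℂ)) 1 t := fun t =>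
    Complex.ofRealCLM.hasDerivAt
  have hf1 := hf.deriv
  have hf2 := hf1.deriv
  have hf3 := hf2.deriv
  set g : ℝ → ℂ := fun t => (t : ℂ) ^ 2 * (t - 1) ^ 2 * deriv (deriv (deriv f)) t
      + t * (t - 1) * (2 * t - 1) * deriv (deriv f) t
    - (t * (-2 * ((t - 1) * deriv f t - f t) * (deriv f t + c) + 4 * B * (t * deriv f t - f t))
      + (t - 1) * (-2 * (t * deriv f t - f t) * (deriv f t + c)
        + 4 * A * ((t - 1) * deriv f t - f t))
      - 2 * (t * deriv f t - f t) * ((t - 1) * deriv f t - f t)) with hg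
  have hga : AnalyticOnNhd ℝ g (Ioo 0 ε) := by
    intro t ht
    have a0 := hf t ht
    have a1 := hf1 t ht
    have a2 := hf2 t ht
    have a3 := hf3 t ht
    have ai := hid t ht
    simp only [hg]
    fun_prop
  have hprod : ∀ t ∈ Ioo 0 ε, deriv (deriv f) t * g t = 0 := by
    intro t ht
    have a0 := (hf t ht).differentiableAt.hasDerivAt
    have a1 := (hf1 t ht).differentiableAt.hasDerivAt
    have a2 := (hf2 t ht).differentiableAt.hasDerivAt
    have ai := hid' t
    have X := (ai.mul a1).sub a0
    have Y := ((ai.sub_const 1).mul a1).sub a0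
    have Z := a1.add_const c
    have hl := ((ai.mul (ai.sub_const 1)).mul a2).pow 2
    have hr := ((((X.const_mul (-4)).mul Y).mul Z).add ((Y.pow 2).const_mul (4 * A))).add
      ((X.pow 2).const_mul (4 * B))
    have he := hl.congr_of_eventuallyEq (f₁ := _) (Filter.eventuallyEq_of_mem
      (isOpen_Ioo.mem_nhds ht) fun r hr => (h r hr).symm)
    have hu := he.unique hr
    simp only [Pi.mul_apply, Pi.sub_apply] at hu
    simp only [hg]
    linear_combination hu / 2
  refine (hf2.eq_zero_or_eq_zero_of_mul_eq_zero hga hprod isPreconnected_Ioo).imp id ?_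
  intro h0 t ht
  exact sub_eq_zero.1 (h0 t ht)

end PVI

/-! ### Two estimates: interpolation of derivatives and integration from `-∞`. -/

namespace PVI

/-- A Landau-Kolmogorov type estimate under a natural growth condition on the third derivative. -/
theorem landau_of_growth {l l₁ l₂ l₃ : ℝ → ℂ} {p δ K : ℝ} (hK : 0 ≤ K)
    (h₁ : ∀ x ∈ Icc p (p + 1), HasDerivAt l (l₁ x) x)
    (h₂ : ∀ x ∈ Icc p (p + 1), HasDerivAt l₁ (l₂ x) x)
    (h₃ : ∀ x ∈ Icc p (p + 1), HasDerivAt l₂ (l₃ x) x)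
    (hl : ∀ x ∈ Icc p (p + 1), ‖l x‖ ≤ δ)
    (hgrow : ∀ x ∈ Icc p (p + 1),
      ‖l₃ x‖ ^ 2 ≤ K ^ 2 * ((‖l₁ x‖ + ‖l₂ x‖) ^ 2 * (1 + (‖l₁ x‖ + ‖l₂ x‖))))
    (hδ : 192 * (1 + 2 * K) ^ 2 * δ ≤ 1 / 2) :
    ∀ x ∈ Icc p (p + 1), ‖l₁ x‖ + ‖l₂ x‖ ≤ 384 * (1 + 2 * K) ^ 2 * δ := by
  have hcont : ContinuousOn (fun x => ‖l₁ x‖ + ‖l₂ x‖) (Icc p (p + 1)) := fun x hx =>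
    ((h₂ x hx).continuousAt.norm.add (h₃ x hx).continuousAt.norm).continuousWithinAt
  obtain ⟨x₀, hx₀, hmax⟩ := isCompact_Icc.exists_isMaxOn
    (nonempty_Icc.2 (by linarith : p ≤ p + 1)) hcont
  set S := ‖l₁ x₀‖ + ‖l₂ x₀‖ with hS
  have hS0 : 0 ≤ S := by positivity
  have hsS : ∀ x ∈ Icc p (p + 1), ‖l₁ x‖ + ‖l₂ x‖ ≤ S := fun x hx => hmax hx
  -- The growth of `l₃` is superlinear, so the step of the finite differences is chosen of order `1
  -- / w`, where `S` is the maximum to be bounded.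
  set w := Real.sqrt (1 + S) with hw
  have hw2 : w ^ 2 = 1 + S := Real.sq_sqrt (by linarith)
  have hw1 : 1 ≤ w := Real.one_le_sqrt.2 (by linarith)
  have hM : ∀ x ∈ Icc p (p + 1), ‖l₃ x‖ ≤ K * S * w := by
    intro x hx
    refine abs_le_of_sq_le_sq' ?_ (by positivity) |>.2
    refine (hgrow x hx).trans ?_
    have := hsS x hx
    rw [mul_pow, mul_pow, hw2, mul_assoc]
    gcongr
  set d := 1 / (4 * (1 + 2 * K)) with hd
  have hd0 : 0 < d := by positivity
  have hd1 : d ≤ 1 / 4 := by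
    rw [hd]
    apply one_div_le_one_div_of_le <;> linarith
  set e := d / w with he
  have he0 : 0 < e := by positivity
  have he1 : e ≤ 1 / 4 := (div_le_self hd0.le hw1).trans hd1
  -- Two steps of length at most `1/4` stay in the interval when taken towards its farther end.
  obtain ⟨h, hh, hmem⟩ : ∃ h : ℝ, |h| = e ∧
      uIcc x₀ (x₀ + h + h) ⊆ Icc p (p + 1) := by
    rcases le_total x₀ (p + 1 / 2) with hx | hx
    · refine ⟨e, abs_of_pos he0, ?_⟩
      rw [uIcc_of_le (by linarith)]
      exact Icc_subset_Icc hx₀.1 (by linarith)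
    · refine ⟨-e, by rw [abs_neg, abs_of_pos he0], ?_⟩
      rw [uIcc_of_ge (by linarith)]
      exact Icc_subset_Icc (by linarith) hx₀.2
  have hsub : ∀ y ∈ uIcc x₀ (x₀ + h), y ∈ uIcc x₀ (x₀ + h + h) ∧ y + h ∈ uIcc x₀ (x₀ + h + h) := by
    intro y hy
    rw [mem_uIcc] at hy ⊢
    rw [mem_uIcc]
    rcases hy with hy | hy
    · exact ⟨Or.inl ⟨by linarith, by linarith⟩, Or.inl ⟨by linarith, by linarith⟩⟩
    · exact ⟨Or.inr ⟨by linarith, by linarith⟩, Or.inr ⟨by linarith, by linarith⟩⟩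
  -- a first-order Taylor estimate
  have taylor : ∀ {u u₁ u₂ : ℝ → ℂ} {C : ℝ}, (∀ x ∈ Icc p (p + 1), HasDerivAt u (u₁ x) x) →
      (∀ x ∈ Icc p (p + 1), HasDerivAt u₁ (u₂ x) x) → (∀ x ∈ Icc p (p + 1), ‖u₂ x‖ ≤ C) →
      ∀ y ∈ Icc p (p + 1), ∀ k : ℝ, uIcc y (y + k) ⊆ Icc p (p + 1) →
        ‖u (y + k) - u y - k * u₁ y‖ ≤ |k| * (|k| * C) := by
    intro u u₁ u₂ C hu hu₁ hu₂ y hy k hk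
    have hb : ∀ z ∈ uIcc y (y + k), ‖u₁ z - u₁ y‖ ≤ |k| * C := by
      intro z hz
      have h := (convex_Icc p (p + 1)).norm_image_sub_le_of_norm_hasDerivWithin_le
        (fun x hx => (hu₁ x hx).hasDerivWithinAt) hu₂ hy (hk hz)
      refine h.trans ?_
      rw [mul_comm, Real.norm_eq_abs]
      have hC : 0 ≤ C := (norm_nonneg _).trans (hu₂ y hy)
      have := abs_sub_left_of_mem_uIcc hz
      rw [add_sub_cancel_left] at this
      gcongr
    have h := (convex_uIcc y (y + k)).norm_image_sub_le_of_norm_hasDerivWithin_le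
      (f := fun x => u x - x * u₁ y) (f' := fun x => u₁ x - u₁ y)
      (fun x hx => by
        have hid : HasDerivAt (fun r : ℝ => (r : ℂ)) 1 x := Complex.ofRealCLM.hasDerivAt
        have := (hu x (hk hx)).sub (hid.mul_const (u₁ y))
        rw [one_mul] at this
        exact this.hasDerivWithinAt) hb left_mem_uIcc right_mem_uIcc
    rw [add_sub_cancel_left, Real.norm_eq_abs, mul_comm (|k| * C)] at h
    refine le_trans (le_of_eq ?_) h
    congr 1
    push_cast
    ring
  have hseg : uIcc x₀ (x₀ + h) ⊆ Icc p (p + 1) := fun y hy => hmem (hsub y hy).1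
  have hend : x₀ + h ∈ Icc p (p + 1) := hseg right_mem_uIcc
  have hend2 : x₀ + h + h ∈ Icc p (p + 1) := hmem right_mem_uIcc
  have t₁ := taylor h₁ h₂ (C := S) (fun x hx => (le_add_of_nonneg_left (norm_nonneg _)).trans
    (hsS x hx)) x₀ hx₀ h hseg
  have b₁ : e * ‖l₁ x₀‖ ≤ 2 * δ + e * (e * S) := by
    have : (h : ℂ) * l₁ x₀ = l (x₀ + h) - l x₀ - (l (x₀ + h) - l x₀ - h * l₁ x₀) := by ring
    have hn := congrArg norm this
    rw [norm_mul, Complex.norm_real, Real.norm_eq_abs, hh] at hn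
    rw [hh] at t₁
    have := norm_sub_le (l (x₀ + h) - l x₀) (l (x₀ + h) - l x₀ - h * l₁ x₀)
    have := norm_sub_le (l (x₀ + h)) (l x₀)
    linarith [hl _ hend, hl _ hx₀]
  -- Estimate of the second difference of `l` with step `h`.
  have b₂ : e * (e * ‖l₂ x₀‖) ≤ 4 * δ + e * (e * (2 * e * (K * S * w))) := by
    have hb : ∀ y ∈ uIcc x₀ (x₀ + h),
        ‖l₁ (y + h) - l₁ y - h * l₂ x₀‖ ≤ 2 * e * (e * (K * S * w)) := by
      intro y hy
      have hy' := hseg hy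
      have hyh : uIcc y (y + h) ⊆ Icc p (p + 1) :=
        (uIcc_subset_uIcc (hsub y hy).1 (hsub y hy).2).trans hmem
      have q₁ := taylor h₂ h₃ hM y hy' h hyh
      have q₂ := (convex_Icc p (p + 1)).norm_image_sub_le_of_norm_hasDerivWithin_le
        (fun x hx => (h₃ x hx).hasDerivWithinAt) hM hx₀ hy'
      have q₃ : ‖l₂ y - l₂ x₀‖ ≤ e * (K * S * w) := by
        refine q₂.trans ?_
        rw [mul_comm, Real.norm_eq_abs]
        have := abs_sub_left_of_mem_uIcc hy
        rw [add_sub_cancel_left, hh] at this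
        gcongr
      have e₁ : l₁ (y + h) - l₁ y - h * l₂ x₀ =
          (l₁ (y + h) - l₁ y - h * l₂ y) + h * (l₂ y - l₂ x₀) := by ring
      rw [e₁]
      refine (norm_add_le _ _).trans ?_
      rw [norm_mul, Complex.norm_real, Real.norm_eq_abs, hh]
      rw [hh] at q₁
      nlinarith
    have hG := (convex_uIcc x₀ (x₀ + h)).norm_image_sub_le_of_norm_hasDerivWithin_le
      (f := fun x => l (x + h) - l x - x * (h * l₂ x₀))
      (f' := fun x => l₁ (x + h) - l₁ x - h * l₂ x₀)
      (fun x hx => by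
        have hid : HasDerivAt (fun r : ℝ => (r : ℂ)) 1 x := Complex.ofRealCLM.hasDerivAt
        have := (((h₁ (x + h) (hmem (hsub x hx).2)).comp_add_const x h).sub
          (h₁ x (hseg hx))).sub (hid.mul_const (h * l₂ x₀))
        rw [one_mul] at this
        exact this.hasDerivWithinAt) hb left_mem_uIcc right_mem_uIcc
    rw [add_sub_cancel_left, Real.norm_eq_abs, hh] at hG
    have : (h : ℂ) * (h * l₂ x₀) = (l (x₀ + h + h) - l (x₀ + h) - (l (x₀ + h) - l x₀)) -
      ((l (x₀ + h + h) - l (x₀ + h) - (x₀ + h : ℝ) * (h * l₂ x₀))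
        - (l (x₀ + h) - l x₀ - x₀ * (h * l₂ x₀))) := by
      push_cast
      ring
    have hn := congrArg norm this
    rw [norm_mul, norm_mul, Complex.norm_real, Real.norm_eq_abs, hh] at hn
    have := norm_sub_le (l (x₀ + h + h) - l (x₀ + h) - (l (x₀ + h) - l x₀))
      ((l (x₀ + h + h) - l (x₀ + h) - (x₀ + h : ℝ) * (h * l₂ x₀))
        - (l (x₀ + h) - l x₀ - x₀ * (h * l₂ x₀)))
    have := norm_sub_le (l (x₀ + h + h) - l (x₀ + h)) (l (x₀ + h) - l x₀)
    have := norm_sub_le (l (x₀ + h + h)) (l (x₀ + h))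
    have := norm_sub_le (l (x₀ + h)) (l x₀)
    nlinarith [hl _ hend, hl _ hx₀, hl _ hend2]
  have hδ0 : 0 ≤ δ := (norm_nonneg _).trans (hl _ hx₀)
  have hew : e * w = d := div_mul_cancel₀ _ (by positivity)
  have hdK : d * (1 + 2 * K) = 1 / 4 := by rw [hd]; field_simp
  have hed : e ≤ d := div_le_self hd0.le hw1
  -- absorb the terms containing `S`
  have key : e * e * S ≤ 6 * δ + e * e * (S / 4) := by
    have c₁ : e * (e * ‖l₁ x₀‖) ≤ 2 * δ + e * (e * (e * S)) := by
      have := mul_le_mul_of_nonneg_left b₁ he0.le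
      nlinarith
    have c₂ : e * (e * (e * S)) ≤ e * (e * (d * S)) := by gcongr
    have c₃ : e * (e * (2 * e * (K * S * w))) = e * (e * (2 * d * (K * S))) := by
      rw [← hew]; ring
    have c₄ : e * (e * (d * S)) + e * (e * (2 * d * (K * S))) = e * e * (S / 4) := by
      linear_combination e * e * S * hdK
    rw [hS]
    rw [c₃] at b₂
    nlinarith
  have hee : e * e * (16 * (1 + 2 * K) ^ 2 * (1 + S)) = 1 := by
    have : e * e * (16 * (1 + 2 * K) ^ 2 * (1 + S)) = (e * w) ^ 2 * (16 * (1 + 2 * K) ^ 2) := by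
      rw [← hw2]; ring
    rw [this, hew]
    linear_combination 16 * (d * (1 + 2 * K) + 1 / 4) * hdK
  -- The constant is `16 * 12`. The smallness of `δ` then absorbs the term with `S` on the right.
  have hfin : S ≤ 192 * (1 + 2 * K) ^ 2 * δ * (1 + S) := by
    have h1 : e * e * S ≤ 12 * δ := by nlinarith [mul_nonneg (mul_nonneg he0.le he0.le) hS0]
    calc S = (e * e * (16 * (1 + 2 * K) ^ 2 * (1 + S))) * S := by rw [hee, one_mul]
      _ = (16 * (1 + 2 * K) ^ 2 * (1 + S)) * (e * e * S) := by ring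
      _ ≤ (16 * (1 + 2 * K) ^ 2 * (1 + S)) * (12 * δ) := by gcongr
      _ = _ := by ring
  intro x hx
  refine (hsS x hx).trans ?_
  nlinarith

/-- Decay of the solutions of `y' = r y + g` on a half line. -/
theorem norm_le_of_hasDerivAt_add {y g : ℝ → ℂ} {r : ℂ} {x₁ G C β β' : ℝ}
    (hd : ∀ x ≤ x₁, HasDerivAt y (r * y x + g x) x)
    (hg : ∀ x ≤ x₁, ‖g x‖ ≤ G * Real.exp (β * x))
    (hy : ∀ x ≤ x₁, ‖y x‖ ≤ C * Real.exp (β' * x)) (hβ : r.re < β) (hβ' : r.re < β') :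
    ∀ x ≤ x₁, ‖y x‖ ≤ G / (β - r.re) * Real.exp (β * x) := by
  set κ := β - r.re with hκ
  have hκ0 : 0 < κ := sub_pos.2 hβ
  -- Integrating factor: `Y' = e ^ (-r x) g` is integrable at `-∞` since `β > Re r`.
  set Y : ℝ → ℂ := fun x => Complex.exp (-r * x) * y x with hY
  have hYd : ∀ x ≤ x₁, HasDerivAt Y (Complex.exp (-r * x) * g x) x := by
    intro x hx
    have hid : HasDerivAt (fun r : ℝ => (r : ℂ)) 1 x := Complex.ofRealCLM.hasDerivAt
    refine ((hid.const_mul (-r)).cexp.mul (hd x hx)).congr_deriv ?_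
    ring
  have hnorm : ∀ x : ℝ, ‖Complex.exp (-r * x)‖ = Real.exp (-r.re * x) := by
    intro x
    rw [Complex.norm_exp]
    simp
  intro x hx
  have hstep : ∀ a ≤ x, ‖Y x‖ ≤ ‖Y a‖ + G / κ * Real.exp (κ * x) := by
    intro a ha
    have hBd : ∀ z : ℝ, HasDerivAt (fun z => ‖Y a‖ + G / κ * (Real.exp (κ * z) - Real.exp (κ * a)))
        (G * Real.exp (κ * z)) z := by
      intro z
      have := ((((hasDerivAt_id z).const_mul κ).exp.sub_const (Real.exp (κ * a))).const_mul
        (G / κ)).const_add ‖Y a‖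
      refine this.congr_deriv ?_
      simp only [id]
      field_simp
    have h := image_norm_le_of_norm_deriv_right_le_deriv_boundary (a := a) (b := x) (f := Y)
      (f' := fun z => Complex.exp (-r * z) * g z)
      (fun z hz => (hYd z (hz.2.trans hx)).continuousAt.continuousWithinAt)
      (fun z hz => (hYd z (hz.2.le.trans hx)).hasDerivWithinAt)
      (B := fun z => ‖Y a‖ + G / κ * (Real.exp (κ * z) - Real.exp (κ * a)))
      (B' := fun z => G * Real.exp (κ * z)) (by simp) hBd
      (fun z hz => by
        rw [norm_mul, hnorm]
        have := hg z (hz.2.le.trans hx)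
        calc Real.exp (-r.re * z) * ‖g z‖ ≤ Real.exp (-r.re * z) * (G * Real.exp (β * z)) := by
              gcongr
          _ = G * Real.exp (κ * z) := by
              rw [mul_left_comm, ← Real.exp_add, hκ]
              ring_nf) (right_mem_Icc.2 ha)
    have hG : 0 ≤ G := by
      have := (norm_nonneg _).trans (hg x hx)
      exact nonneg_of_mul_nonneg_left this (Real.exp_pos _)
    refine h.trans ?_
    have : 0 ≤ G / κ * Real.exp (κ * a) := by positivity
    linarith
  -- The a priori decay with `β' > Re r` excludes the homogeneous solution `e ^ (r x)`: the boundary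
  -- term at `a` vanishes as `a → -∞`.
  have hlim : Tendsto (fun a : ℝ => C * Real.exp ((β' - r.re) * a) + G / κ * Real.exp (κ * x)) atBot
      (𝓝 (C * 0 + G / κ * Real.exp (κ * x))) := by
    refine ((Real.tendsto_exp_atBot.comp ?_).const_mul C).add_const _
    exact tendsto_id.const_mul_atBot (sub_pos.2 hβ')
  have hYx : ‖Y x‖ ≤ G / κ * Real.exp (κ * x) := by
    refine (ge_of_tendsto hlim ?_).trans (by simp)
    filter_upwards [Iic_mem_atBot x] with a ha
    refine (hstep a ha).trans ?_
    gcongr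
    rw [hY]
    simp only
    rw [norm_mul, hnorm]
    calc Real.exp (-r.re * a) * ‖y a‖ ≤ Real.exp (-r.re * a) * (C * Real.exp (β' * a)) := by
          gcongr
          exact hy a (le_trans ha hx)
      _ = C * Real.exp ((β' - r.re) * a) := by
          rw [mul_left_comm, ← Real.exp_add]
          ring_nf
  have hyY : ‖y x‖ = Real.exp (r.re * x) * ‖Y x‖ := by
    rw [hY]
    simp only
    rw [norm_mul, hnorm, ← mul_assoc, ← Real.exp_add]
    simp
  rw [hyY]
  calc Real.exp (r.re * x) * ‖Y x‖ ≤ Real.exp (r.re * x) * (G / κ * Real.exp (κ * x)) := by gcongr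
    _ = G / κ * Real.exp (β * x) := by
        rw [mul_left_comm, ← Real.exp_add, hκ]
        ring_nf

end PVI

/-! ### Decay of `σ` and its derivatives at `t = 0`. -/

namespace PVI

/-- The `σ`-form in the variable `x = ln t`: `φ₀` is a solution, `φ₁, φ₂, φ₃` are its derivatives
with respect to `x`, and `φ₀ = (t - 1) dl/dx`. -/
structure SigmaFlow (A B c : ℂ) (x₀ : ℝ) (φ₀ φ₁ φ₂ φ₃ l : ℝ → ℂ) : Prop where
  exp_le : Real.exp x₀ ≤ 1 / 2
  deriv_zero : ∀ x ≤ x₀, HasDerivAt φ₀ (φ₁ x) x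
  deriv_one : ∀ x ≤ x₀, HasDerivAt φ₁ (φ₂ x) x
  deriv_two : ∀ x ≤ x₀, HasDerivAt φ₂ (φ₃ x) x
  deriv_log : ∀ x ≤ x₀, HasDerivAt l (φ₀ x / ((Real.exp x : ℝ) - 1)) x
  form : ∀ x ≤ x₀, ((((Real.exp x : ℝ) : ℂ) - 1) * (φ₂ x - φ₁ x)) ^ 2 =
    -4 * (φ₁ x - φ₀ x) * (((Real.exp x : ℝ) - 1) * φ₁ x - (Real.exp x : ℝ) * φ₀ x)
        * (φ₁ x + c * (Real.exp x : ℝ))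
      + 4 * A * (((Real.exp x : ℝ) - 1) * φ₁ x - (Real.exp x : ℝ) * φ₀ x) ^ 2
      + 4 * B * ((Real.exp x : ℝ) * (φ₁ x - φ₀ x)) ^ 2

theorem norm_sq_le_of_sigmaForm {A B c φ₀ φ₁ φ₂ : ℂ} {t s : ℝ} (ht : 0 ≤ t) (ht' : t ≤ 1 / 2)
    (hs : s = ‖φ₀‖ + ‖φ₁‖)
    (h : (((t : ℂ) - 1) * (φ₂ - φ₁)) ^ 2 =
      -4 * (φ₁ - φ₀) * ((t - 1) * φ₁ - t * φ₀) * (φ₁ + c * t)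
        + 4 * A * ((t - 1) * φ₁ - t * φ₀) ^ 2 + 4 * B * (t * (φ₁ - φ₀)) ^ 2) :
    ‖φ₂‖ ^ 2 ≤ (34 + 32 * (‖A‖ + ‖B‖ + ‖c‖)) * (s ^ 2 * (1 + s)) := by
  have hs0 : 0 ≤ s := by rw [hs]; positivity
  have h0 : ‖φ₀‖ ≤ s := by rw [hs]; linarith [norm_nonneg φ₁]
  have h1 : ‖φ₁‖ ≤ s := by rw [hs]; linarith [norm_nonneg φ₀]
  have ht1 : ‖(t : ℂ) - 1‖ = 1 - t := by
    rw [← Complex.ofReal_one, ← Complex.ofReal_sub, Complex.norm_real, Real.norm_eq_abs, abs_sub_comm,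
      abs_of_nonneg (by linarith)]
  have htn : ‖(t : ℂ)‖ = t := by rw [Complex.norm_real, Real.norm_eq_abs, abs_of_nonneg ht]
  have hp : ‖φ₁ - φ₀‖ ≤ s := by rw [hs]; linarith [norm_sub_le φ₁ φ₀]
  have hq : ‖((t : ℂ) - 1) * φ₁ - t * φ₀‖ ≤ s := by
    refine (norm_sub_le _ _).trans ?_
    rw [norm_mul, norm_mul, ht1, htn, hs]
    nlinarith [norm_nonneg φ₀, norm_nonneg φ₁]
  have hr : ‖φ₁ + c * t‖ ≤ s + ‖c‖ := by
    refine (norm_add_le _ _).trans ?_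
    rw [norm_mul, htn]
    nlinarith [norm_nonneg c]
  have htp : ‖(t : ℂ) * (φ₁ - φ₀)‖ ≤ s := by
    rw [norm_mul, htn]
    nlinarith [norm_nonneg (φ₁ - φ₀)]
  have hR : ‖-4 * (φ₁ - φ₀) * (((t : ℂ) - 1) * φ₁ - t * φ₀) * (φ₁ + c * t)
      + 4 * A * ((t - 1) * φ₁ - t * φ₀) ^ 2 + 4 * B * (t * (φ₁ - φ₀)) ^ 2‖ ≤
      4 * s * s * (s + ‖c‖) + 4 * ‖A‖ * s ^ 2 + 4 * ‖B‖ * s ^ 2 := by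
    refine (norm_add₃_le).trans ?_
    simp only [norm_mul, norm_pow, norm_neg, Complex.norm_ofNat]
    rw [norm_mul] at htp
    gcongr
  rw [← h, norm_pow, norm_mul, ht1] at hR
  have hd : ‖φ₂ - φ₁‖ ^ 2 ≤ 4 * (4 * s * s * (s + ‖c‖) + 4 * ‖A‖ * s ^ 2 + 4 * ‖B‖ * s ^ 2) := by
    have : (1 / 2 * ‖φ₂ - φ₁‖) ^ 2 ≤ ((1 - t) * ‖φ₂ - φ₁‖) ^ 2 := by gcongr; linarith
    nlinarith
  have h2 : ‖φ₂‖ ≤ ‖φ₂ - φ₁‖ + s := by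
    have := norm_add_le (φ₂ - φ₁) φ₁
    rw [sub_add_cancel] at this
    linarith
  have h3 : ‖φ₂‖ ^ 2 ≤ 2 * ‖φ₂ - φ₁‖ ^ 2 + 2 * s ^ 2 := by
    nlinarith [norm_nonneg φ₂, norm_nonneg (φ₂ - φ₁), sq_nonneg (‖φ₂ - φ₁‖ - s)]
  have hk : 0 ≤ (‖A‖ + ‖B‖ + ‖c‖) * s ^ 3 := by positivity
  have hs3 : 0 ≤ s ^ 3 := by positivity
  nlinarith

/-- The `σ`-form bounds `φ₂`, hence the third derivative of `l`, by lower derivatives with the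
growth that `landau_of_growth` admits. Decay of `l` alone therefore passes to its derivatives. -/
theorem SigmaFlow.norm_le {A B c : ℂ} {x₀ M ρ : ℝ} {φ₀ φ₁ φ₂ φ₃ l : ℝ → ℂ}
    (h : SigmaFlow A B c x₀ φ₀ φ₁ φ₂ φ₃ l) (hρ : 0 < ρ)
    (hl : ∀ x ≤ x₀, ‖l x‖ ≤ M * Real.exp (ρ * x)) :
    ∃ C, ∃ x₁ ≤ x₀, ∀ x ≤ x₁, ‖φ₀ x‖ + ‖φ₁ x‖ + ‖φ₂ x‖ ≤ C * Real.exp (ρ * x) := by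
  set k := 34 + 32 * (‖A‖ + ‖B‖ + ‖c‖) with hk
  have hk0 : 0 ≤ k := by positivity
  set K := Real.sqrt (64 * k + 8) with hK
  have hK2 : K ^ 2 = 64 * k + 8 := Real.sq_sqrt (by positivity)
  have ht : ∀ x ≤ x₀, Real.exp x ≤ 1 / 2 := fun x hx =>
    (Real.exp_le_exp.2 hx).trans h.exp_le
  have htn : ∀ x : ℝ, ‖((Real.exp x : ℝ) : ℂ)‖ = Real.exp x := fun x => by
    rw [Complex.norm_real, Real.norm_eq_abs, abs_of_pos (Real.exp_pos x)]
  have ht1 : ∀ x ≤ x₀, ‖((Real.exp x : ℝ) : ℂ) - 1‖ = 1 - Real.exp x := by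
    intro x hx
    rw [← Complex.ofReal_one, ← Complex.ofReal_sub, Complex.norm_real, Real.norm_eq_abs,
      abs_sub_comm, abs_of_nonneg (by linarith [ht x hx])]
  have hne : ∀ x ≤ x₀, ((Real.exp x : ℝ) : ℂ) - 1 ≠ 0 := by
    intro x hx h0
    have := ht1 x hx
    rw [h0, norm_zero] at this
    linarith [ht x hx]
  set l₁ : ℝ → ℂ := fun x => φ₀ x / ((Real.exp x : ℝ) - 1) with hl₁
  set l₂ : ℝ → ℂ := fun x => (φ₁ x - (Real.exp x : ℝ) * l₁ x) / ((Real.exp x : ℝ) - 1) with hl₂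
  set l₃ : ℝ → ℂ := fun x =>
    (φ₂ x - (Real.exp x : ℝ) * l₁ x - 2 * (Real.exp x : ℝ) * l₂ x) / ((Real.exp x : ℝ) - 1) with hl₃
  have hexp : ∀ x : ℝ, HasDerivAt (fun x : ℝ => ((Real.exp x : ℝ) : ℂ)) ((Real.exp x : ℝ) : ℂ) x :=
    fun x => (Real.hasDerivAt_exp x).ofReal_comp
  have d₁ : ∀ x ≤ x₀, HasDerivAt l₁ (l₂ x) x := by
    intro x hx
    refine ((h.deriv_zero x hx).div ((hexp x).sub_const 1) (hne x hx)).congr_deriv ?_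
    have := hne x hx
    simp only [hl₂, hl₁]
    field_simp
  have d₂ : ∀ x ≤ x₀, HasDerivAt l₂ (l₃ x) x := by
    intro x hx
    refine (((h.deriv_one x hx).sub ((hexp x).mul (d₁ x hx))).div ((hexp x).sub_const 1)
      (hne x hx)).congr_deriv ?_
    have := hne x hx
    simp only [hl₃, Pi.sub_apply, Pi.mul_apply]
    have e : φ₁ x - (Real.exp x : ℝ) * l₁ x = ((Real.exp x : ℝ) - 1) * l₂ x := by
      rw [hl₂]; field_simp
    rw [e]
    field_simp
    ring
  have bφ : ∀ x ≤ x₀, ‖φ₀ x‖ + ‖φ₁ x‖ ≤ 2 * (‖l₁ x‖ + ‖l₂ x‖) := by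
    intro x hx
    have e₀ : φ₀ x = ((Real.exp x : ℝ) - 1) * l₁ x :=
      (mul_div_cancel₀ _ (hne x hx)).symm
    have e₁ : φ₁ x = ((Real.exp x : ℝ) - 1) * l₂ x + (Real.exp x : ℝ) * l₁ x := by
      have := hne x hx
      rw [hl₂]; field_simp; ring
    have n₀ : ‖φ₀ x‖ ≤ ‖l₁ x‖ := by
      rw [e₀, norm_mul, ht1 x hx]
      nlinarith [norm_nonneg (l₁ x), Real.exp_pos x]
    have n₁ : ‖φ₁ x‖ ≤ ‖l₂ x‖ + ‖l₁ x‖ := by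
      rw [e₁]
      refine (norm_add_le _ _).trans ?_
      rw [norm_mul, norm_mul, ht1 x hx, htn]
      nlinarith [norm_nonneg (l₁ x), norm_nonneg (l₂ x), Real.exp_pos x, ht x hx]
    linarith [norm_nonneg (l₂ x)]
  have b₂ : ∀ x ≤ x₀, ‖φ₂ x‖ ^ 2 ≤
      8 * k * ((‖l₁ x‖ + ‖l₂ x‖) ^ 2 * (1 + (‖l₁ x‖ + ‖l₂ x‖))) := by
    intro x hx
    have := norm_sq_le_of_sigmaForm (Real.exp_pos x).le (ht x hx) rfl (h.form x hx)
    refine this.trans ?_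
    have hb := bφ x hx
    have hb' : 1 + (‖φ₀ x‖ + ‖φ₁ x‖) ≤ 2 * (1 + (‖l₁ x‖ + ‖l₂ x‖)) := by linarith
    calc k * ((‖φ₀ x‖ + ‖φ₁ x‖) ^ 2 * (1 + (‖φ₀ x‖ + ‖φ₁ x‖))) ≤
        k * ((2 * (‖l₁ x‖ + ‖l₂ x‖)) ^ 2 * (2 * (1 + (‖l₁ x‖ + ‖l₂ x‖)))) := by gcongr
      _ = _ := by ring
  have b₃ : ∀ x ≤ x₀, ‖l₃ x‖ ^ 2 ≤
      K ^ 2 * ((‖l₁ x‖ + ‖l₂ x‖) ^ 2 * (1 + (‖l₁ x‖ + ‖l₂ x‖))) := by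
    intro x hx
    have hh := b₂ x hx
    set s := ‖l₁ x‖ + ‖l₂ x‖ with hs
    have hs0 : 0 ≤ s := by positivity
    have e : φ₂ x - (Real.exp x : ℝ) * l₁ x - 2 * (Real.exp x : ℝ) * l₂ x =
        ((Real.exp x : ℝ) - 1) * l₃ x :=
      (mul_div_cancel₀ _ (hne x hx)).symm
    have n₃ : 1 / 2 * ‖l₃ x‖ ≤ ‖φ₂ x‖ + s := by
      have e' := congrArg norm e
      rw [norm_mul, ht1 x hx] at e'
      have i₁ := norm_sub_le (φ₂ x - (Real.exp x : ℝ) * l₁ x) (2 * (Real.exp x : ℝ) * l₂ x)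
      have i₂ := norm_sub_le (φ₂ x) ((Real.exp x : ℝ) * l₁ x)
      rw [norm_mul, norm_mul, htn, Complex.norm_ofNat] at i₁
      rw [norm_mul, htn] at i₂
      nlinarith [norm_nonneg (l₁ x), norm_nonneg (l₂ x), norm_nonneg (l₃ x), Real.exp_pos x, ht x hx]
    have n₃' : (1 / 2 * ‖l₃ x‖) ^ 2 ≤ (‖φ₂ x‖ + s) ^ 2 := by gcongr
    rw [hK2]
    have : s ^ 2 ≤ s ^ 2 * (1 + s) := by nlinarith [sq_nonneg s]
    nlinarith [sq_nonneg (‖φ₂ x‖ - s)]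
  set R := 192 * (1 + 2 * K) ^ 2 with hR
  have hK0 : 0 ≤ K := Real.sqrt_nonneg _
  have hR0 : 0 < R := by positivity
  have hlim : Tendsto (fun x : ℝ => R * (M * Real.exp (ρ * x))) atBot (𝓝 (R * (M * 0))) :=
    ((Real.tendsto_exp_atBot.comp (tendsto_id.const_mul_atBot hρ)).const_mul M).const_mul R
  rw [mul_zero, mul_zero] at hlim
  obtain ⟨x₁, hx₁⟩ := (hlim.eventually_le_const (by norm_num : (0 : ℝ) < 1 / 2)).exists_forall_of_atBot
  refine ⟨4 * (R * M) + 8 * k.sqrt * (R * M), min x₁ x₀ , min_le_right _ _, ?_⟩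
  intro x hx
  have hx0 : x ≤ x₀ := hx.trans (min_le_right _ _)
  have hI : ∀ y ∈ Icc (x - 1) (x - 1 + 1), y ≤ x₀ := fun y hy => by linarith [hy.2]
  have hM0 : 0 ≤ M := nonneg_of_mul_nonneg_left ((norm_nonneg _).trans (hl x hx0)) (Real.exp_pos _)
  have hsm := hx₁ x (hx.trans (min_le_left _ _))
  -- On `[x - 1, x]` the bound for `l` is largest at the right end, so no decay is lost.
  have hland := landau_of_growth (p := x - 1) (δ := M * Real.exp (ρ * x)) hK0
    (fun y hy => h.deriv_log y (hI y hy)) (fun y hy => d₁ y (hI y hy)) (fun y hy => d₂ y (hI y hy))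
    (fun y hy => (hl y (hI y hy)).trans (by gcongr; linarith [hy.2]))
    (fun y hy => b₃ y (hI y hy)) hsm x ⟨by linarith, by linarith⟩
  have hs : ‖l₁ x‖ + ‖l₂ x‖ ≤ 2 * (R * (M * Real.exp (ρ * x))) := by
    refine hland.trans (le_of_eq ?_)
    rw [hR]; ring
  have hs1 : ‖l₁ x‖ + ‖l₂ x‖ ≤ 1 := by linarith
  have hφ₂ : ‖φ₂ x‖ ≤ 4 * k.sqrt * (‖l₁ x‖ + ‖l₂ x‖) := by
    refine abs_le_of_sq_le_sq' ?_ (by positivity) |>.2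
    refine (b₂ x hx0).trans ?_
    rw [mul_pow, mul_pow, Real.sq_sqrt hk0]
    have : (‖l₁ x‖ + ‖l₂ x‖) ^ 2 * (1 + (‖l₁ x‖ + ‖l₂ x‖)) ≤ (‖l₁ x‖ + ‖l₂ x‖) ^ 2 * 2 := by
      gcongr; linarith
    nlinarith
  have := bφ x hx0
  have hks : 0 ≤ k.sqrt := Real.sqrt_nonneg _
  have : 4 * k.sqrt * (‖l₁ x‖ + ‖l₂ x‖) ≤ 4 * k.sqrt * (2 * (R * (M * Real.exp (ρ * x)))) := by
    gcongr
  linarith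

end PVI

/-! ### Uniqueness for the flow in `x = ln t`. -/

namespace PVI

/-- The differentiated `σ`-form in the variable `x = ln t`. -/
def FlowDeriv (A B c t φ₀ φ₁ φ₂ φ₃ : ℂ) : Prop :=
  (t - 1) ^ 2 * (φ₃ - 3 * φ₂ + 2 * φ₁) + (t - 1) * (2 * t - 1) * (φ₂ - φ₁) =
    -2 * ((t - 1) * φ₁ - t * φ₀) * (φ₁ + c * t) + 4 * B * t ^ 2 * (φ₁ - φ₀)
      + (t - 1) * (-2 * (φ₁ - φ₀) * (φ₁ + c * t) + 4 * A * ((t - 1) * φ₁ - t * φ₀))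
      - 2 * (φ₁ - φ₀) * ((t - 1) * φ₁ - t * φ₀)

theorem norm_mul_sub_mul_le {p q p' q' : ℂ} {s P Q : ℝ} (hp' : ‖p'‖ ≤ P) (hq : ‖q‖ ≤ Q)
    (hp : ‖p - p'‖ ≤ s) (hqq : ‖q - q'‖ ≤ s) : ‖p * q - p' * q'‖ ≤ s * (P + Q) := by
  have : p * q - p' * q' = (p - p') * q + p' * (q - q') := by ring
  rw [this]
  refine (norm_add_le _ _).trans ?_
  rw [norm_mul, norm_mul]
  have hs : 0 ≤ s := (norm_nonneg _).trans hp
  have hP : 0 ≤ P := (norm_nonneg _).trans hp'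
  have h1 : ‖p - p'‖ * ‖q‖ ≤ s * Q := by gcongr
  have h2 : ‖p'‖ * ‖q - q'‖ ≤ P * s := by gcongr
  linarith

/-- The operator on the left is the `t → 0` limit of the linear part of `FlowDeriv`. Every other
term carries a factor `t`, either explicitly or, in the quadratic terms, because both solutions are
`O(t)`. -/
theorem FlowDeriv.norm_linear_le {a B c φ₀ φ₁ φ₂ φ₃ ψ₀ ψ₁ ψ₂ ψ₃ : ℂ} {t M : ℝ} (ht : 0 ≤ t)
    (ht' : t ≤ 1 / 2) (hφ : FlowDeriv (a ^ 2 / 4) B c t φ₀ φ₁ φ₂ φ₃)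
    (hψ : FlowDeriv (a ^ 2 / 4) B c t ψ₀ ψ₁ ψ₂ ψ₃)
    (hφM : ‖φ₀‖ + ‖φ₁‖ ≤ M * t) (hψM : ‖ψ₀‖ + ‖ψ₁‖ ≤ M * t) :
    ‖(φ₃ - ψ₃) - 2 * (φ₂ - ψ₂) + (1 - a ^ 2) * (φ₁ - ψ₁)‖ ≤
      (8 + 4 * ‖a‖ ^ 2 + 16 * ‖B‖ + 48 * M + 16 * ‖c‖) * t
        * (‖φ₀ - ψ₀‖ + ‖φ₁ - ψ₁‖ + ‖φ₂ - ψ₂‖) := by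
  set s := ‖φ₀ - ψ₀‖ + ‖φ₁ - ψ₁‖ + ‖φ₂ - ψ₂‖ with hs
  have n0 := norm_nonneg (φ₀ - ψ₀)
  have n1 := norm_nonneg (φ₁ - ψ₁)
  have n2 := norm_nonneg (φ₂ - ψ₂)
  have ht1 : ‖(t : ℂ) - 1‖ = 1 - t := by
    rw [← Complex.ofReal_one, ← Complex.ofReal_sub, Complex.norm_real, Real.norm_eq_abs, abs_sub_comm,
      abs_of_nonneg (by linarith)]
  have htn : ‖(t : ℂ)‖ = t := by rw [Complex.norm_real, Real.norm_eq_abs, abs_of_nonneg ht]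
  have hs0 : 0 ≤ s := by positivity
  have hp : ∀ u v : ℂ, ‖u‖ + ‖v‖ ≤ M * t → ‖v - u‖ ≤ M * t := fun u v h =>
    (norm_sub_le _ _).trans (by linarith)
  have hq : ∀ u v : ℂ, ‖((t : ℂ) - 1) * v - t * u‖ ≤ ‖u‖ + ‖v‖ := by
    intro u v
    refine (norm_sub_le _ _).trans ?_
    rw [norm_mul, norm_mul, ht1, htn]
    nlinarith [norm_nonneg u, norm_nonneg v]
  have hr : ‖φ₁ + c * t‖ ≤ M * t + ‖c‖ * t := by
    refine (norm_add_le _ _).trans ?_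
    rw [norm_mul, htn]
    linarith [norm_nonneg φ₀]
  have dp : ‖(φ₁ - φ₀) - (ψ₁ - ψ₀)‖ ≤ s := by
    have : (φ₁ - φ₀) - (ψ₁ - ψ₀) = (φ₁ - ψ₁) - (φ₀ - ψ₀) := by ring
    rw [this]
    exact (norm_sub_le _ _).trans (by linarith)
  have dq : ‖(((t : ℂ) - 1) * φ₁ - t * φ₀) - ((t - 1) * ψ₁ - t * ψ₀)‖ ≤ s := by
    have : (((t : ℂ) - 1) * φ₁ - t * φ₀) - ((t - 1) * ψ₁ - t * ψ₀) =
      (t - 1) * (φ₁ - ψ₁) - t * (φ₀ - ψ₀) := by ring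
    rw [this]
    exact (hq _ _).trans (by linarith)
  have dr : ‖(φ₁ + c * t) - (ψ₁ + c * t)‖ ≤ s := by
    rw [add_sub_add_right_eq_sub]
    linarith
  have D₁ := norm_mul_sub_mul_le ((hq ψ₀ ψ₁).trans hψM) hr dq dr
  have D₂ := norm_mul_sub_mul_le (hp _ _ hψM) hr dp dr
  have D₃ := norm_mul_sub_mul_le (hp _ _ hψM) ((hq φ₀ φ₁).trans hφM) dp dq
  have key : ((t : ℂ) - 1) ^ 2 * ((φ₃ - ψ₃) - 2 * (φ₂ - ψ₂) + (1 - a ^ 2) * (φ₁ - ψ₁)) =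
      t * (-(t - 1) * ((φ₂ - ψ₂) - (φ₁ - ψ₁)) - a ^ 2 * ((t - 1) * (φ₀ - ψ₀))
        + 4 * B * (t * ((φ₁ - ψ₁) - (φ₀ - ψ₀))))
      - 2 * ((((t - 1) * φ₁ - t * φ₀) * (φ₁ + c * t)
          - ((t - 1) * ψ₁ - t * ψ₀) * (ψ₁ + c * t))
        + (t - 1) * ((φ₁ - φ₀) * (φ₁ + c * t) - (ψ₁ - ψ₀) * (ψ₁ + c * t))
        + ((φ₁ - φ₀) * ((t - 1) * φ₁ - t * φ₀) - (ψ₁ - ψ₀) * ((t - 1) * ψ₁ - t * ψ₀))) := by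
    unfold FlowDeriv at hφ hψ
    linear_combination hφ - hψ
  have hlin : ‖-((t : ℂ) - 1) * ((φ₂ - ψ₂) - (φ₁ - ψ₁)) - a ^ 2 * ((t - 1) * (φ₀ - ψ₀))
      + 4 * B * (t * ((φ₁ - ψ₁) - (φ₀ - ψ₀)))‖ ≤ 2 * s + ‖a‖ ^ 2 * s + 4 * ‖B‖ * s := by
    have i₁ : ‖-((t : ℂ) - 1) * ((φ₂ - ψ₂) - (φ₁ - ψ₁))‖ ≤ 2 * s := by
      rw [norm_mul, norm_neg, ht1]
      have := norm_sub_le (φ₂ - ψ₂) (φ₁ - ψ₁)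
      nlinarith [norm_nonneg ((φ₂ - ψ₂) - (φ₁ - ψ₁))]
    have i₂ : ‖a ^ 2 * (((t : ℂ) - 1) * (φ₀ - ψ₀))‖ ≤ ‖a‖ ^ 2 * s := by
      rw [norm_mul, norm_pow, norm_mul, ht1]
      gcongr
      nlinarith
    have i₃ : ‖4 * B * ((t : ℂ) * ((φ₁ - ψ₁) - (φ₀ - ψ₀)))‖ ≤ 4 * ‖B‖ * s := by
      rw [norm_mul, norm_mul, norm_mul, htn, Complex.norm_ofNat]
      gcongr
      have := norm_sub_le (φ₁ - ψ₁) (φ₀ - ψ₀)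
      nlinarith [norm_nonneg ((φ₁ - ψ₁) - (φ₀ - ψ₀))]
    refine (norm_add_le _ _).trans ?_
    have := norm_sub_le (-((t : ℂ) - 1) * ((φ₂ - ψ₂) - (φ₁ - ψ₁))) (a ^ 2 * ((t - 1) * (φ₀ - ψ₀)))
    linarith
  have hD₂ : ‖((t : ℂ) - 1) * ((φ₁ - φ₀) * (φ₁ + c * t) - (ψ₁ - ψ₀) * (ψ₁ + c * t))‖ ≤
      s * (M * t + (M * t + ‖c‖ * t)) := by
    rw [norm_mul, ht1]
    nlinarith [norm_nonneg ((φ₁ - φ₀) * (φ₁ + c * t) - (ψ₁ - ψ₀) * (ψ₁ + c * t))]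
  have hnorm := congrArg norm key
  rw [norm_mul, norm_pow, ht1] at hnorm
  have hrhs : (1 - t) ^ 2 * ‖(φ₃ - ψ₃) - 2 * (φ₂ - ψ₂) + (1 - a ^ 2) * (φ₁ - ψ₁)‖ ≤
      t * (2 * s + ‖a‖ ^ 2 * s + 4 * ‖B‖ * s) + 2 * (s * (M * t + (M * t + ‖c‖ * t))
        + s * (M * t + (M * t + ‖c‖ * t)) + s * (M * t + M * t)) := by
    rw [hnorm]
    refine (norm_sub_le _ _).trans (add_le_add ?_ ?_)
    · rw [norm_mul, htn]
      gcongr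
    · rw [norm_mul, Complex.norm_ofNat]
      gcongr
      exact norm_add₃_le.trans (add_le_add (add_le_add D₁ hD₂) D₃)
  have hquarter : 1 / 4 * ‖(φ₃ - ψ₃) - 2 * (φ₂ - ψ₂) + (1 - a ^ 2) * (φ₁ - ψ₁)‖ ≤
      (1 - t) ^ 2 * ‖(φ₃ - ψ₃) - 2 * (φ₂ - ψ₂) + (1 - a ^ 2) * (φ₁ - ψ₁)‖ := by
    gcongr
    nlinarith
  linarith

/-- One step of the successive integration of the linearised equation, whose exponents are
`0`, `1 - a` and `1 + a`. -/
theorem norm_le_of_linear {a : ℂ} {x₁ G C β β' : ℝ} (ha : 0 < a.re) {η₀ η₁ η₂ η₃ : ℝ → ℂ}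
    (d₀ : ∀ x ≤ x₁, HasDerivAt η₀ (η₁ x) x) (d₁ : ∀ x ≤ x₁, HasDerivAt η₁ (η₂ x) x)
    (d₂ : ∀ x ≤ x₁, HasDerivAt η₂ (η₃ x) x)
    (hG : ∀ x ≤ x₁, ‖η₃ x - 2 * η₂ x + (1 - a ^ 2) * η₁ x‖ ≤ G * Real.exp (β * x))
    (hC : ∀ x ≤ x₁, ‖η₀ x‖ + ‖η₁ x‖ + ‖η₂ x‖ ≤ C * Real.exp (β' * x))
    (hβ : β = 2 + a.re) (hβ' : 1 + a.re ≤ β') :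
    (∀ x ≤ x₁, ‖η₂ x - 2 * η₁ x + (1 - a ^ 2) * η₀ x‖ ≤ G * Real.exp (β * x)) ∧
      ∀ x ≤ x₁, ‖η₁ x - (1 + a) * η₀ x‖ ≤ G * Real.exp (β * x) := by
  have hG0 : 0 ≤ G := nonneg_of_mul_nonneg_left ((norm_nonneg _).trans (hG x₁ le_rfl))
    (Real.exp_pos _)
  have h₁ : ∀ x ≤ x₁, ‖η₂ x - 2 * η₁ x + (1 - a ^ 2) * η₀ x‖ ≤ G * Real.exp (β * x) := by
    -- The characteristic polynomial is `r (r - (1 - a)) (r - (1 + a))`. Here the factor with root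
    -- `0` is inverted, and below the one with root `1 - a`. The root `1 + a` would require `β' > 1
    -- + Re a`.
    have h := norm_le_of_hasDerivAt_add (r := 0) (β := β) (β' := β') (G := G)
      (C := (2 + ‖1 - a ^ 2‖) * C)
      (y := fun x => η₂ x - 2 * η₁ x + (1 - a ^ 2) * η₀ x)
      (g := fun x => η₃ x - 2 * η₂ x + (1 - a ^ 2) * η₁ x)
      (fun x hx => (((d₂ x hx).sub ((d₁ x hx).const_mul 2)).add
        ((d₀ x hx).const_mul (1 - a ^ 2))).congr_deriv (by ring)) hG
      (fun x hx => by
        have h := hC x hx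
        refine norm_add_le _ _ |>.trans ?_
        have h2 := norm_sub_le (η₂ x) (2 * η₁ x)
        rw [norm_mul, Complex.norm_ofNat] at h2
        rw [norm_mul, mul_assoc]
        have : (2 + ‖1 - a ^ 2‖) * (‖η₀ x‖ + ‖η₁ x‖ + ‖η₂ x‖) ≤
          (2 + ‖1 - a ^ 2‖) * (C * Real.exp (β' * x)) := by gcongr
        nlinarith [norm_nonneg (η₀ x), norm_nonneg (η₁ x), norm_nonneg (η₂ x),
          norm_nonneg (1 - a ^ 2), mul_nonneg (norm_nonneg (1 - a ^ 2)) (norm_nonneg (η₁ x)),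
          mul_nonneg (norm_nonneg (1 - a ^ 2)) (norm_nonneg (η₂ x))])
      (by rw [Complex.zero_re]; linarith) (by rw [Complex.zero_re]; linarith)
    intro x hx
    refine (h x hx).trans ?_
    gcongr
    rw [Complex.zero_re]
    exact div_le_self hG0 (by linarith)
  refine ⟨h₁, ?_⟩
  have h := norm_le_of_hasDerivAt_add (r := 1 - a) (β := β) (β' := β') (G := G)
      (C := (1 + ‖1 + a‖) * C)
      (y := fun x => η₁ x - (1 + a) * η₀ x)
      (g := fun x => η₂ x - 2 * η₁ x + (1 - a ^ 2) * η₀ x)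
      (fun x hx => ((d₁ x hx).sub ((d₀ x hx).const_mul (1 + a))).congr_deriv (by ring)) h₁
      (fun x hx => by
        have h := hC x hx
        refine norm_sub_le _ _ |>.trans ?_
        rw [norm_mul, mul_assoc]
        have : (1 + ‖1 + a‖) * (‖η₀ x‖ + ‖η₁ x‖ + ‖η₂ x‖) ≤
          (1 + ‖1 + a‖) * (C * Real.exp (β' * x)) := by gcongr
        nlinarith [norm_nonneg (η₀ x), norm_nonneg (η₁ x), norm_nonneg (η₂ x),
          norm_nonneg (1 + a), mul_nonneg (norm_nonneg (1 + a)) (norm_nonneg (η₁ x)),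
          mul_nonneg (norm_nonneg (1 + a)) (norm_nonneg (η₂ x))])
      (by simp; linarith) (by simp; linarith)
  intro x hx
  refine (h x hx).trans ?_
  gcongr
  refine div_le_self hG0 ?_
  simp
  linarith

/-- The a priori rate `1 + Re a` is exactly that of the mode `1 + a`, so the last factor cannot be
inverted at once. The faster decay of `lam`, where the equality of the `κ` enters, removes this
mode. After that every factor is invertible at the rate `2 + Re a`, and the error factor `e ^ x`
gives a contraction. -/
theorem eq_zero_of_linear {a : ℂ} {x₀ K C M : ℝ} (ha : 0 < a.re) (hK : 0 ≤ K)
    {η₀ η₁ η₂ η₃ lam : ℝ → ℂ} (hx₀ : Real.exp x₀ ≤ 1 / 2)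
    (d₀ : ∀ x ≤ x₀, HasDerivAt η₀ (η₁ x) x) (d₁ : ∀ x ≤ x₀, HasDerivAt η₁ (η₂ x) x)
    (d₂ : ∀ x ≤ x₀, HasDerivAt η₂ (η₃ x) x)
    (dl : ∀ x ≤ x₀, HasDerivAt lam (η₀ x / ((Real.exp x : ℝ) - 1)) x)
    (hE : ∀ x ≤ x₀, ‖η₃ x - 2 * η₂ x + (1 - a ^ 2) * η₁ x‖ ≤
      K * Real.exp x * (‖η₀ x‖ + ‖η₁ x‖ + ‖η₂ x‖))
    (hC : ∀ x ≤ x₀, ‖η₀ x‖ + ‖η₁ x‖ + ‖η₂ x‖ ≤ C * Real.exp ((1 + a.re) * x))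
    (hM : ∀ x ≤ x₀, ‖lam x‖ ≤ M * Real.exp ((2 + a.re) * x)) :
    ∃ x₁ ≤ x₀, ∀ x ≤ x₁, η₀ x = 0 := by
  set β := 2 + a.re with hβ
  have hexp : ∀ x : ℝ, Real.exp x * Real.exp ((1 + a.re) * x) = Real.exp (β * x) := fun x => by
    rw [← Real.exp_add]
    congr 1
    rw [hβ]; ring
  have hC0 : 0 ≤ C := nonneg_of_mul_nonneg_left ((by positivity : (0 : ℝ) ≤ _).trans (hC x₀ le_rfl))
    (Real.exp_pos _)
  -- the step from `η₀` to all of the `ηᵢ`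
  have hstep : ∀ {x G N : ℝ}, ‖η₂ x - 2 * η₁ x + (1 - a ^ 2) * η₀ x‖ ≤ G →
      ‖η₁ x - (1 + a) * η₀ x‖ ≤ G → ‖η₀ x‖ ≤ N →
      ‖η₀ x‖ + ‖η₁ x‖ + ‖η₂ x‖ ≤ 4 * G + (1 + 3 * ‖1 + a‖ + ‖1 - a ^ 2‖) * N := by
    intro x G N g₁ g₂ g₃
    have e₁ : η₁ x = (η₁ x - (1 + a) * η₀ x) + (1 + a) * η₀ x := by ring
    have e₂ : η₂ x = (η₂ x - 2 * η₁ x + (1 - a ^ 2) * η₀ x) + 2 * η₁ x - (1 - a ^ 2) * η₀ x := by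
      ring
    have n₁ := norm_add_le (η₁ x - (1 + a) * η₀ x) ((1 + a) * η₀ x)
    rw [← e₁, norm_mul] at n₁
    have n₂ := norm_sub_le ((η₂ x - 2 * η₁ x + (1 - a ^ 2) * η₀ x) + 2 * η₁ x)
      ((1 - a ^ 2) * η₀ x)
    rw [← e₂, norm_mul] at n₂
    have n₃ := norm_add_le (η₂ x - 2 * η₁ x + (1 - a ^ 2) * η₀ x) (2 * η₁ x)
    rw [norm_mul 2, Complex.norm_ofNat] at n₃
    have m₁ : ‖1 + a‖ * ‖η₀ x‖ ≤ ‖1 + a‖ * N := by gcongr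
    have m₂ : ‖1 - a ^ 2‖ * ‖η₀ x‖ ≤ ‖1 - a ^ 2‖ * N := by gcongr
    linarith
  set b := 1 + 3 * ‖1 + a‖ + ‖1 - a ^ 2‖ with hb
  have hb0 : 0 ≤ b := by positivity
  -- improvement of the decay
  obtain ⟨N₀, hN₀⟩ : ∃ N, ∀ x ≤ x₀, ‖η₀ x‖ + ‖η₁ x‖ + ‖η₂ x‖ ≤ N * Real.exp (β * x) := by
    have hG : ∀ x ≤ x₀, ‖η₃ x - 2 * η₂ x + (1 - a ^ 2) * η₁ x‖ ≤ K * C * Real.exp (β * x) := by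
      intro x hx
      refine (hE x hx).trans ?_
      rw [← hexp]
      have := hC x hx
      calc K * Real.exp x * (‖η₀ x‖ + ‖η₁ x‖ + ‖η₂ x‖) ≤
          K * Real.exp x * (C * Real.exp ((1 + a.re) * x)) := by gcongr
        _ = _ := by ring
    obtain ⟨h₁, h₂⟩ := norm_le_of_linear ha d₀ d₁ d₂ hG hC hβ le_rfl
    have hq : ∀ x ≤ x₀, ‖η₀ x / ((Real.exp x : ℝ) - 1)‖ ≤ 2 * C * Real.exp ((1 + a.re) * x) := by
      intro x hx
      have ht : Real.exp x ≤ 1 / 2 := (Real.exp_le_exp.2 hx).trans hx₀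
      rw [norm_div, ← Complex.ofReal_one, ← Complex.ofReal_sub, Complex.norm_real, Real.norm_eq_abs,
        abs_sub_comm, abs_of_nonneg (by linarith), div_le_iff₀ (by linarith)]
      have hp : 0 ≤ C * Real.exp ((1 + a.re) * x) := by positivity
      have := hC x hx
      nlinarith [norm_nonneg (η₁ x), norm_nonneg (η₂ x)]
    -- Since `lam' = η₀ / (e ^ x - 1)` is close to `-η₀`, the derivative of `-η₀ - (1 + a) lam` has
    -- the better rate `β`. Integration has exponent `0` instead of `1 + a`, and the bound for `lam`
    -- then yields one for `η₀`.
    have h₃ := norm_le_of_hasDerivAt_add (r := 0) (β := β) (β' := 1 + a.re)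
      (G := K * C + ‖1 + a‖ * (2 * C)) (C := C + ‖1 + a‖ * |M|) (x₁ := min x₀ 0)
      (y := fun x => -η₀ x - (1 + a) * lam x)
      (g := fun x => -(η₁ x - (1 + a) * η₀ x)
        - (1 + a) * ((Real.exp x : ℝ) * (η₀ x / ((Real.exp x : ℝ) - 1))))
      (fun x hx => by
        have hx0 := hx.trans (min_le_left _ _)
        refine ((d₀ x hx0).neg.sub ((dl x hx0).const_mul (1 + a))).congr_deriv ?_
        have hne : ((Real.exp x : ℝ) : ℂ) - 1 ≠ 0 := by
          have ht : Real.exp x ≤ 1 / 2 := (Real.exp_le_exp.2 hx0).trans hx₀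
          rw [← Complex.ofReal_one, ← Complex.ofReal_sub]
          exact_mod_cast (by linarith : Real.exp x - 1 < 0).ne
        field_simp
        ring)
      (fun x hx => by
        have hx0 := hx.trans (min_le_left _ _)
        refine (norm_sub_le _ _).trans ?_
        rw [norm_neg, norm_mul, norm_mul, Complex.norm_real, Real.norm_eq_abs,
          abs_of_pos (Real.exp_pos x), add_mul (K * C)]
        refine add_le_add (h₂ x hx0) ?_
        rw [← hexp]
        calc ‖1 + a‖ * (Real.exp x * ‖η₀ x / ((Real.exp x : ℝ) - 1)‖) ≤
            ‖1 + a‖ * (Real.exp x * (2 * C * Real.exp ((1 + a.re) * x))) := by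
              gcongr
              exact hq x hx0
          _ = _ := by ring)
      (fun x hx => by
        have hx0 := hx.trans (min_le_left _ _)
        refine (norm_sub_le _ _).trans ?_
        rw [norm_neg, norm_mul, add_mul _ (‖1 + a‖ * _)]
        refine add_le_add (by linarith [hC x hx0, norm_nonneg (η₁ x), norm_nonneg (η₂ x)]) ?_
        rw [mul_assoc]
        gcongr
        refine (hM x hx0).trans ?_
        have : Real.exp (β * x) ≤ Real.exp ((1 + a.re) * x) := by
          rw [Real.exp_le_exp, hβ]
          nlinarith [hx.trans (min_le_right _ _)]
        have h1 := le_abs_self M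
        have h2 := abs_nonneg M
        calc M * Real.exp (β * x) ≤ |M| * Real.exp (β * x) := by gcongr
          _ ≤ _ := by gcongr)
      (by rw [Complex.zero_re]; linarith) (by rw [Complex.zero_re]; linarith)
    have hx₀0 : x₀ ≤ 0 := Real.exp_le_one_iff.1 (by linarith)
    rw [min_eq_left hx₀0, Complex.zero_re, sub_zero] at h₃
    set W := (K * C + ‖1 + a‖ * (2 * C)) / β with hW
    refine ⟨4 * (K * C) + b * (W + ‖1 + a‖ * M), fun x hx => ?_⟩
    have hη : ‖η₀ x‖ ≤ (W + ‖1 + a‖ * M) * Real.exp (β * x) := by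
      have e : η₀ x = -(-η₀ x - (1 + a) * lam x) - (1 + a) * lam x := by ring
      rw [e]
      refine (norm_sub_le _ _).trans ?_
      rw [norm_neg, norm_mul, add_mul _ (‖1 + a‖ * _)]
      refine add_le_add (h₃ x hx) ?_
      rw [mul_assoc]
      gcongr
      exact hM x hx
    refine (hstep (h₁ x hx) (h₂ x hx) hη).trans (le_of_eq ?_)
    ring
  -- contraction
  set L := K * (4 + b) with hL
  have hL0 : 0 ≤ L := by positivity
  have hlim : Tendsto (fun x : ℝ => L * Real.exp x) atBot (𝓝 (L * 0)) :=
    Real.tendsto_exp_atBot.const_mul L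
  rw [mul_zero] at hlim
  obtain ⟨x₂, hx₂⟩ := (hlim.eventually_le_const (by norm_num : (0 : ℝ) < 1 / 2)).exists_forall_of_atBot
  set x₁ := min x₂ x₀ with hx₁
  have hx₁0 : x₁ ≤ x₀ := min_le_right _ _
  have hcontr : ∀ N : ℝ, (∀ x ≤ x₁, ‖η₀ x‖ + ‖η₁ x‖ + ‖η₂ x‖ ≤ N * Real.exp (β * x)) →
      ∀ x ≤ x₁, ‖η₀ x‖ + ‖η₁ x‖ + ‖η₂ x‖ ≤ N / 2 * Real.exp (β * x) := by
    intro N hN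
    have hN0 : 0 ≤ N := nonneg_of_mul_nonneg_left
      ((by positivity : (0 : ℝ) ≤ _).trans (hN x₁ le_rfl)) (Real.exp_pos _)
    have hG : ∀ x ≤ x₁, ‖η₃ x - 2 * η₂ x + (1 - a ^ 2) * η₁ x‖ ≤
        K * Real.exp x₁ * N * Real.exp (β * x) := by
      intro x hx
      refine (hE x (hx.trans hx₁0)).trans ?_
      have := hN x hx
      calc K * Real.exp x * (‖η₀ x‖ + ‖η₁ x‖ + ‖η₂ x‖) ≤
          K * Real.exp x₁ * (N * Real.exp (β * x)) := by gcongr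
        _ = _ := by ring
    have d₀' := fun x (hx : x ≤ x₁) => d₀ x (hx.trans hx₁0)
    have d₁' := fun x (hx : x ≤ x₁) => d₁ x (hx.trans hx₁0)
    have d₂' := fun x (hx : x ≤ x₁) => d₂ x (hx.trans hx₁0)
    obtain ⟨h₁, h₂⟩ := norm_le_of_linear ha d₀' d₁' d₂' hG hN hβ (by linarith)
    -- At the rate `β = 2 + Re a` the factor with root `1 + a` can be inverted, with constant `1 /
    -- (β - Re (1 + a)) = 1`.
    have h₃ := norm_le_of_hasDerivAt_add (r := 1 + a) (β := β) (β' := β)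
      (G := K * Real.exp x₁ * N) (C := N) (y := η₀) (g := fun x => η₁ x - (1 + a) * η₀ x)
      (fun x hx => (d₀' x hx).congr_deriv (by ring)) h₂
      (fun x hx => by linarith [hN x hx, norm_nonneg (η₁ x), norm_nonneg (η₂ x)])
      (by simp; linarith) (by simp; linarith)
    have hβ1 : β - (1 + a).re = 1 := by simp [hβ]; ring
    rw [hβ1, div_one] at h₃
    intro x hx
    refine (hstep (h₁ x hx) (h₂ x hx) (h₃ x hx)).trans ?_
    have h4 := hx₂ x₁ (min_le_left _ _)
    calc 4 * (K * Real.exp x₁ * N * Real.exp (β * x)) + b * (K * Real.exp x₁ * N * Real.exp (β * x))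
        = (L * Real.exp x₁) * N * Real.exp (β * x) := by rw [hL]; ring
      _ ≤ 1 / 2 * N * Real.exp (β * x) := by gcongr
      _ = _ := by ring
  have hiter : ∀ n : ℕ, ∀ x ≤ x₁, ‖η₀ x‖ + ‖η₁ x‖ + ‖η₂ x‖ ≤
      N₀ * (1 / 2) ^ n * Real.exp (β * x) := by
    intro n
    induction n with
    | zero => exact fun x hx => by simpa using hN₀ x (hx.trans hx₁0)
    | succ n ih =>
      intro x hx
      refine (hcontr _ ih x hx).trans (le_of_eq ?_)
      rw [pow_succ]; ring
  refine ⟨x₁, hx₁0, fun x hx => ?_⟩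
  have hlim2 : Tendsto (fun n : ℕ => N₀ * (1 / 2 : ℝ) ^ n * Real.exp (β * x)) atTop
      (𝓝 (N₀ * 0 * Real.exp (β * x))) :=
    ((tendsto_pow_atTop_nhds_zero_of_lt_one (by norm_num) (by norm_num)).const_mul N₀).mul_const _
  have hle := ge_of_tendsto' hlim2 fun n => hiter n x hx
  rw [mul_zero, zero_mul] at hle
  exact norm_le_zero_iff.1 (by linarith [norm_nonneg (η₁ x), norm_nonneg (η₂ x)])

theorem SigmaFlow.unique {a B c : ℂ} {x₀ M M' : ℝ} {φ₀ φ₁ φ₂ φ₃ l ψ₀ ψ₁ ψ₂ ψ₃ m : ℝ → ℂ}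
    (ha : 0 < a.re) (hφ : SigmaFlow (a ^ 2 / 4) B c x₀ φ₀ φ₁ φ₂ φ₃ l)
    (hψ : SigmaFlow (a ^ 2 / 4) B c x₀ ψ₀ ψ₁ ψ₂ ψ₃ m)
    (hφ' : ∀ x ≤ x₀, FlowDeriv (a ^ 2 / 4) B c (Real.exp x : ℝ) (φ₀ x) (φ₁ x) (φ₂ x) (φ₃ x))
    (hψ' : ∀ x ≤ x₀, FlowDeriv (a ^ 2 / 4) B c (Real.exp x : ℝ) (ψ₀ x) (ψ₁ x) (ψ₂ x) (ψ₃ x))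
    (hl : ∀ x ≤ x₀, ‖l x‖ ≤ M * Real.exp ((1 + a.re) * x))
    (hm : ∀ x ≤ x₀, ‖m x‖ ≤ M * Real.exp ((1 + a.re) * x))
    (hlm : ∀ x ≤ x₀, ‖l x - m x‖ ≤ M' * Real.exp ((2 + a.re) * x)) :
    ∃ x₁ ≤ x₀, ∀ x ≤ x₁, l x = m x := by
  obtain ⟨C, x₁, hx₁, h₁⟩ := hφ.norm_le (by linarith : 0 < 1 + a.re) hl
  obtain ⟨C', x₂, hx₂, h₂⟩ := hψ.norm_le (by linarith : 0 < 1 + a.re) hm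
  set y := min x₁ x₂ with hy
  have hy₁ : y ≤ x₁ := min_le_left _ _
  have hy₂ : y ≤ x₂ := min_le_right _ _
  have hy₀ : y ≤ x₀ := hy₁.trans hx₁
  have hexpy : Real.exp y ≤ 1 / 2 := (Real.exp_le_exp.2 hy₀).trans hφ.exp_le
  have hyneg : y ≤ 0 := Real.exp_le_one_iff.1 (by linarith)
  set N := max C C' with hN
  have hN0 : 0 ≤ N := le_max_of_le_left (nonneg_of_mul_nonneg_left
    ((by positivity : (0 : ℝ) ≤ _).trans (h₁ x₁ le_rfl)) (Real.exp_pos _))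
  have hbound : ∀ x ≤ y, ‖φ₀ x‖ + ‖φ₁ x‖ + ‖φ₂ x‖ ≤ N * Real.exp ((1 + a.re) * x) ∧
      ‖ψ₀ x‖ + ‖ψ₁ x‖ + ‖ψ₂ x‖ ≤ N * Real.exp ((1 + a.re) * x) := by
    intro x hx
    refine ⟨(h₁ x (hx.trans hy₁)).trans ?_, (h₂ x (hx.trans hy₂)).trans ?_⟩
    · gcongr
      exact le_max_left _ _
    · gcongr
      exact le_max_right _ _
  -- Provides the bounds `O(t)` needed in `FlowDeriv.norm_linear_le`.
  have hsmall : ∀ x ≤ y, N * Real.exp ((1 + a.re) * x) ≤ N * Real.exp x := by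
    intro x hx
    gcongr
    nlinarith
  obtain ⟨x₃, hx₃, h₃⟩ := eq_zero_of_linear (x₀ := y) (C := 2 * N) (M := M')
    (K := 8 + 4 * ‖a‖ ^ 2 + 16 * ‖B‖ + 48 * N + 16 * ‖c‖) ha (by positivity)
    (η₀ := fun x => φ₀ x - ψ₀ x) (η₁ := fun x => φ₁ x - ψ₁ x) (η₂ := fun x => φ₂ x - ψ₂ x)
    (η₃ := fun x => φ₃ x - ψ₃ x) (lam := fun x => l x - m x) hexpy
    (fun x hx => (hφ.deriv_zero x (hx.trans hy₀)).sub (hψ.deriv_zero x (hx.trans hy₀)))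
    (fun x hx => (hφ.deriv_one x (hx.trans hy₀)).sub (hψ.deriv_one x (hx.trans hy₀)))
    (fun x hx => (hφ.deriv_two x (hx.trans hy₀)).sub (hψ.deriv_two x (hx.trans hy₀)))
    (fun x hx => ((hφ.deriv_log x (hx.trans hy₀)).sub (hψ.deriv_log x (hx.trans hy₀))).congr_deriv
      (by rw [sub_div]))
    (fun x hx => (hφ' x (hx.trans hy₀)).norm_linear_le (Real.exp_pos x).le
      ((Real.exp_le_exp.2 hx).trans hexpy) (hψ' x (hx.trans hy₀))
      (by linarith [(hbound x hx).1, hsmall x hx, norm_nonneg (φ₂ x)])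
      (by linarith [(hbound x hx).2, hsmall x hx, norm_nonneg (ψ₂ x)]))
    (fun x hx => by
      have i₀ := norm_sub_le (φ₀ x) (ψ₀ x)
      have i₁ := norm_sub_le (φ₁ x) (ψ₁ x)
      have i₂ := norm_sub_le (φ₂ x) (ψ₂ x)
      linarith [(hbound x hx).1, (hbound x hx).2])
    (fun x hx => hlm x (hx.trans hy₀))
  refine ⟨x₃, hx₃.trans hy₀, ?_⟩
  -- With equal `σ`, the difference of the logarithms is constant, and it decays.
  have hd := norm_le_of_hasDerivAt_add (r := 0) (β := 1) (β' := 2 + a.re) (G := 0) (C := M')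
    (x₁ := x₃) (y := fun x => l x - m x) (g := fun _ => 0)
    (fun x hx => by
      have hx0 := hx.trans (hx₃.trans hy₀)
      refine ((hφ.deriv_log x hx0).sub (hψ.deriv_log x hx0)).congr_deriv ?_
      rw [← sub_div, h₃ x hx]
      simp)
    (fun x _ => by simp) (fun x hx => hlm x (hx.trans (hx₃.trans hy₀)))
    (by simp) (by rw [Complex.zero_re]; linarith)
  intro x hx
  have := hd x hx
  rw [zero_div, zero_mul] at this
  exact sub_eq_zero.1 (norm_le_zero_iff.1 this)

end PVI

/-! ### From the expansion of `τ` at `0` to equality on `(0,1)`. -/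

namespace PVI

theorem norm_log_sub_log_le {z w : ℂ} (hz : z ∈ Metric.ball (1 : ℂ) (1 / 2))
    (hw : w ∈ Metric.ball (1 : ℂ) (1 / 2)) : ‖Complex.log z - Complex.log w‖ ≤ 2 * ‖z - w‖ := by
  have hre : ∀ u ∈ Metric.ball (1 : ℂ) (1 / 2), 1 / 2 < u.re := by
    intro u hu
    rw [mem_ball_iff_norm] at hu
    have := (Complex.abs_re_le_norm (u - 1)).trans_lt hu
    rw [abs_lt, Complex.sub_re, Complex.one_re] at this
    linarith [this.1]
  refine (convex_ball (1 : ℂ) (1 / 2)).norm_image_sub_le_of_norm_hasDerivWithin_le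
    (fun u hu => (Complex.hasDerivAt_log (Or.inl (by linarith [hre u hu]))).hasDerivWithinAt)
    (fun u hu => ?_) hw hz
  have h1 := (hre u hu).trans_le ((le_abs_self _).trans (Complex.abs_re_le_norm u))
  rw [norm_inv]
  exact inv_le_of_inv_le₀ (by norm_num) (by linarith)

/-- `τ = 1 - κ t ^ (1 + a) + O(t ^ (2 + a))` as `t → 0+`. -/
def HasExpansion (κ a : ℂ) (τ : ℝ → ℂ) : Prop :=
  (fun t : ℝ => τ t - (1 - κ * (t : ℂ) ^ (1 + a))) =O[𝓝[>] 0] fun t : ℝ => (t : ℂ) ^ (2 + a)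

theorem HasExpansion.exists_bound {κ a : ℂ} {τ : ℝ → ℂ} (h : HasExpansion κ a τ)
    (ha : 0 < a.re) :
    ∃ K : ℝ, ∃ ε : ℝ, 0 < ε ∧ ε ≤ 1 / 2 ∧ ∀ t ∈ Ioo 0 ε,
      ‖τ t - (1 - κ * (t : ℂ) ^ (1 + a))‖ ≤ K * t ^ (2 + a.re) ∧
      ‖τ t - 1‖ ≤ (K + ‖κ‖) * t ^ (1 + a.re) ∧ ‖τ t - 1‖ < 1 / 2 := by
  obtain ⟨K, hK0, hK⟩ := h.exists_pos
  obtain ⟨ε₀, hε₀, hε⟩ := mem_nhdsGT_iff_exists_Ioo_subset.1 hK.bound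
  rw [mem_Ioi] at hε₀
  have hKκ : 0 < K + ‖κ‖ := by positivity
  refine ⟨K, min ε₀ (min (1 / 2) (1 / (2 * (K + ‖κ‖)))), by positivity,
    (min_le_right _ _).trans (min_le_left _ _), fun t ht => ?_⟩
  have ht0 : 0 < t := ht.1
  have h1 : t < ε₀ := ht.2.trans_le (min_le_left _ _)
  have h2 : t < 1 / 2 := ht.2.trans_le ((min_le_right _ _).trans (min_le_left _ _))
  have h3 : t < 1 / (2 * (K + ‖κ‖)) := ht.2.trans_le ((min_le_right _ _).trans (min_le_right _ _))
  have b₁ : ‖τ t - (1 - κ * (t : ℂ) ^ (1 + a))‖ ≤ K * t ^ (2 + a.re) := by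
    have := hε ⟨ht0, h1⟩
    simp only [Set.mem_ofPred_eq, Complex.norm_cpow_eq_rpow_re_of_pos ht0] at this
    simpa using this
  have hn : ‖κ * (t : ℂ) ^ (1 + a)‖ = ‖κ‖ * t ^ (1 + a.re) := by
    rw [norm_mul, Complex.norm_cpow_eq_rpow_re_of_pos ht0]
    simp
  have hle : t ^ (2 + a.re) ≤ t ^ (1 + a.re) :=
    Real.rpow_le_rpow_of_exponent_ge ht0 (by linarith) (by linarith)
  have hle' : t ^ (1 + a.re) ≤ t := by
    have := Real.rpow_le_rpow_of_exponent_ge ht0 (by linarith) (by linarith : 1 ≤ 1 + a.re)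
    rwa [Real.rpow_one] at this
  have b₂ : ‖τ t - 1‖ ≤ (K + ‖κ‖) * t ^ (1 + a.re) := by
    have e : τ t - 1 = (τ t - (1 - κ * (t : ℂ) ^ (1 + a))) - κ * (t : ℂ) ^ (1 + a) := by ring
    rw [e, add_mul]
    refine (norm_sub_le _ _).trans (add_le_add (b₁.trans ?_) hn.le)
    gcongr
  refine ⟨b₁, b₂, b₂.trans_lt ?_⟩
  rw [lt_div_iff₀ (by positivity)] at h3
  have : (K + ‖κ‖) * t ^ (1 + a.re) ≤ (K + ‖κ‖) * t := by gcongr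
  linarith

theorem exp_rpow (x p : ℝ) : Real.exp x ^ p = Real.exp (p * x) := by
  rw [← Real.exp_mul, mul_comm]

/-- Near `0` the expansion keeps `τ` within `1/2` of `1`, so `σ` is analytic there and the principal
logarithm is smooth along `τ`. The bounds hold for all `x₀ ≤ y` so that two such flows can be
compared on a common half line. -/
theorem exists_sigmaFlow {A B c κ a : ℂ} {τ : ℝ → ℂ} (hτ : AnalyticOnNhd ℝ τ (Ioo 0 1))
    (hσ : OffDiscrete fun t =>
      SigmaForm A B c t (sigma τ t) (deriv (sigma τ) t) (deriv (deriv (sigma τ)) t))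
    (h : HasExpansion κ a τ) (ha : 0 < a.re) (hκ : κ ≠ 0) :
    ∃ φ₀ φ₁ φ₂ φ₃ : ℝ → ℂ, ∃ K y : ℝ, ∀ x₀ ≤ y,
      SigmaFlow A B c x₀ φ₀ φ₁ φ₂ φ₃ (fun x => Complex.log (τ (Real.exp x))) ∧
      (∀ x ≤ x₀, FlowDeriv A B c (Real.exp x : ℝ) (φ₀ x) (φ₁ x) (φ₂ x) (φ₃ x)) ∧
      ∀ x ≤ x₀, τ (Real.exp x) ∈ Metric.ball (1 : ℂ) (1 / 2) ∧
        ‖Complex.log (τ (Real.exp x))‖ ≤ K * Real.exp ((1 + a.re) * x) ∧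
        ‖τ (Real.exp x) - (1 - κ * ((Real.exp x : ℝ) : ℂ) ^ (1 + a))‖ ≤
          K * Real.exp ((2 + a.re) * x) := by
  obtain ⟨K, ε, hε0, hε, hb⟩ := h.exists_bound ha
  have hε1 : ε ≤ 1 := by linarith
  set f := sigma τ with hfdef
  have hball : ∀ t ∈ Ioo 0 ε, τ t ∈ Metric.ball (1 : ℂ) (1 / 2) := fun t ht => by
    rw [mem_ball_iff_norm]
    exact (hb t ht).2.2
  have hne : ∀ t ∈ Ioo 0 ε, τ t ≠ 0 := by
    intro t ht h0
    have := (hb t ht).2.2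
    rw [h0, zero_sub, norm_neg, norm_one] at this
    norm_num at this
  have hfa := analyticOnNhd_sigma hτ hε1 hne
  have hform := sigmaForm_of_offDiscrete hε1 hfa hσ
  have hfa1 := hfa.deriv
  have hfa2 := hfa1.deriv
  set y := Real.log (ε / 2) with hy
  have hexpy : ∀ x ≤ y, Real.exp x ∈ Ioo 0 ε := by
    intro x hx
    refine ⟨Real.exp_pos x, ?_⟩
    have := Real.exp_le_exp.2 hx
    rw [hy, Real.exp_log (by positivity)] at this
    linarith
  have hexp : ∀ x : ℝ, HasDerivAt (fun x : ℝ => ((Real.exp x : ℝ) : ℂ)) ((Real.exp x : ℝ) : ℂ) x :=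
    fun x => (Real.hasDerivAt_exp x).ofReal_comp
  have hcomp : ∀ {g : ℝ → ℂ}, AnalyticOnNhd ℝ g (Ioo 0 ε) → ∀ x ≤ y,
      HasDerivAt (fun x => g (Real.exp x)) ((Real.exp x : ℝ) * deriv g (Real.exp x)) x := by
    intro g hg x hx
    have := (hg _ (hexpy x hx)).differentiableAt.hasDerivAt.scomp x (Real.hasDerivAt_exp x)
    rwa [Complex.real_smul] at this
  set φ₀ : ℝ → ℂ := fun x => f (Real.exp x) with hφ₀
  set φ₁ : ℝ → ℂ := fun x => (Real.exp x : ℝ) * deriv f (Real.exp x) with hφ₁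
  set φ₂ : ℝ → ℂ := fun x => (Real.exp x : ℝ) * deriv f (Real.exp x)
    + (Real.exp x : ℝ) * ((Real.exp x : ℝ) * deriv (deriv f) (Real.exp x)) with hφ₂
  set φ₃ : ℝ → ℂ := fun x => (Real.exp x : ℝ) * deriv f (Real.exp x)
    + 3 * ((Real.exp x : ℝ) * ((Real.exp x : ℝ) * deriv (deriv f) (Real.exp x)))
    + (Real.exp x : ℝ) * ((Real.exp x : ℝ) *
      ((Real.exp x : ℝ) * deriv (deriv (deriv f)) (Real.exp x))) with hφ₃
  have hflow : ∀ x₀ ≤ y, SigmaFlow A B c x₀ φ₀ φ₁ φ₂ φ₃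
      (fun x => Complex.log (τ (Real.exp x))) := by
    intro x₀ hx₀
    refine ⟨by linarith [(hexpy x₀ hx₀).2], fun x hx => hcomp hfa x (hx.trans hx₀), fun x hx => ?_,
      fun x hx => ?_, fun x hx => ?_, fun x hx => ?_⟩
    · exact (hexp x).mul (hcomp hfa1 x (hx.trans hx₀))
    · refine (((hexp x).mul (hcomp hfa1 x (hx.trans hx₀))).add
        ((hexp x).mul ((hexp x).mul (hcomp hfa2 x (hx.trans hx₀))))).congr_deriv ?_
      simp only [hφ₃, Pi.mul_apply]
      ring
    · have hxy := hx.trans hx₀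
      have hm := hexpy x hxy
      have hτd := (hτ _ ⟨hm.1, hm.2.trans_le hε1⟩).differentiableAt.hasDerivAt.scomp x
        (Real.hasDerivAt_exp x)
      have hslit : τ (Real.exp x) ∈ Complex.slitPlane := by
        have := Complex.mem_slitPlane_of_norm_lt_one (z := τ (Real.exp x) - 1)
          ((hb _ hm).2.2.trans (by norm_num))
        rwa [add_sub_cancel] at this
      refine (hτd.clog_real hslit).congr_deriv ?_
      have h1 : ((Real.exp x : ℝ) : ℂ) - 1 ≠ 0 := by
        rw [← Complex.ofReal_one, ← Complex.ofReal_sub]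
        exact_mod_cast (by linarith [hm.2] : Real.exp x - 1 < 0).ne
      have h2 := hne _ hm
      simp only [hφ₀, hfdef, sigma, Complex.real_smul, Function.comp_apply]
      field_simp
    · have := hform _ (hexpy x (hx.trans hx₀))
      unfold SigmaForm at this
      simp only [hφ₀, hφ₁, hφ₂]
      linear_combination ((Real.exp x : ℝ) : ℂ) ^ 2 * this
  have hlog : ∀ x ≤ y, ‖Complex.log (τ (Real.exp x))‖ ≤
      2 * (K + ‖κ‖) * Real.exp ((1 + a.re) * x) := by
    intro x hx
    have h1 := norm_log_sub_log_le (hball _ (hexpy x hx)) (Metric.mem_ball_self (by norm_num))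
    rw [Complex.log_one, sub_zero] at h1
    have h2 := (hb _ (hexpy x hx)).2.1
    rw [exp_rpow] at h2
    linarith
  -- If `σ'' = 0`, then `φ₁` is a multiple of `e ^ x`, which decays too slowly unless it is zero.
  -- Then `σ` and `ln τ` are constant and decaying, so `τ = 1` near `0`, against `κ ≠ 0`.
  rcases sigmaFormDeriv_or hfa hform with h0 | h3
  · exfalso
    replace h0 : ∀ t ∈ Ioo 0 ε, deriv (deriv f) t = 0 := h0
    obtain ⟨C, x₁, hx₁, hC⟩ := (hflow y le_rfl).norm_le (by linarith : 0 < 1 + a.re) hlog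
    have z₁ : ∀ x ≤ x₁, φ₁ x = 0 := by
      have := norm_le_of_hasDerivAt_add (r := 1) (β := 2) (β' := 1 + a.re) (G := 0) (C := C)
        (x₁ := x₁) (y := φ₁) (g := fun _ => 0)
        (fun x hx => ((hflow y le_rfl).deriv_one x (hx.trans hx₁)).congr_deriv (by
          simp [hφ₂, hφ₁, h0 _ (hexpy x (hx.trans hx₁))]))
        (fun x _ => by simp)
        (fun x hx => by linarith [hC x hx, norm_nonneg (φ₀ x), norm_nonneg (φ₂ x)])
        (by simp) (by simp; linarith)
      intro x hx
      simpa using this x hx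
    have z₀ : ∀ x ≤ x₁, φ₀ x = 0 := by
      have := norm_le_of_hasDerivAt_add (r := 0) (β := 2) (β' := 1 + a.re) (G := 0) (C := C)
        (x₁ := x₁) (y := φ₀) (g := fun _ => 0)
        (fun x hx => ((hflow y le_rfl).deriv_zero x (hx.trans hx₁)).congr_deriv (by
          simp [z₁ x hx]))
        (fun x _ => by simp)
        (fun x hx => by linarith [hC x hx, norm_nonneg (φ₁ x), norm_nonneg (φ₂ x)])
        (by simp) (by simp; linarith)
      intro x hx
      simpa using this x hx
    have zl : ∀ x ≤ x₁, Complex.log (τ (Real.exp x)) = 0 := by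
      have := norm_le_of_hasDerivAt_add (r := 0) (β := 2) (β' := 1 + a.re) (G := 0)
        (C := 2 * (K + ‖κ‖)) (x₁ := x₁) (y := fun x => Complex.log (τ (Real.exp x)))
        (g := fun _ => 0)
        (fun x hx => ((hflow y le_rfl).deriv_log x (hx.trans hx₁)).congr_deriv (by
          simp [z₀ x hx]))
        (fun x _ => by simp) (fun x hx => hlog x (hx.trans hx₁))
        (by simp) (by simp; linarith)
      intro x hx
      simpa using this x hx
    have hκle : ∀ x ≤ x₁, ‖κ‖ ≤ K * Real.exp x := by
      intro x hx
      have hm := hexpy x (hx.trans hx₁)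
      have h1 := (hb _ hm).1
      have hτ1 : τ (Real.exp x) = 1 := by
        rw [← Complex.exp_log (hne _ hm), zl x hx, Complex.exp_zero]
      rw [hτ1, sub_sub_cancel, norm_mul, Complex.norm_cpow_eq_rpow_re_of_pos hm.1, exp_rpow,
        exp_rpow] at h1
      have e : Real.exp ((2 + a.re) * x) = Real.exp x * Real.exp ((1 + a).re * x) := by
        rw [← Real.exp_add]
        simp
        ring
      rw [e, ← mul_assoc] at h1
      exact le_of_mul_le_mul_right h1 (Real.exp_pos _)
    have hlim := ge_of_tendsto (Real.tendsto_exp_atBot.const_mul K)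
      (mem_of_superset (Iic_mem_atBot x₁) fun x hx => hκle x hx)
    rw [mul_zero] at hlim
    exact hκ (norm_le_zero_iff.1 hlim)
  · refine ⟨φ₀, φ₁, φ₂, φ₃, 2 * (|K| + ‖κ‖), y, fun x₀ hx₀ => ⟨hflow x₀ hx₀, fun x hx => ?_,
      fun x hx => ⟨hball _ (hexpy x (hx.trans hx₀)), (hlog x (hx.trans hx₀)).trans ?_, ?_⟩⟩⟩
    · have := h3 _ (hexpy x (hx.trans hx₀))
      unfold SigmaFormDeriv at this
      simp only [FlowDeriv, hφ₀, hφ₁, hφ₂, hφ₃]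
      linear_combination ((Real.exp x : ℝ) : ℂ) * this
    · gcongr
      exact le_abs_self K
    · have := (hb _ (hexpy x (hx.trans hx₀))).1
      rw [exp_rpow] at this
      refine this.trans ?_
      gcongr
      linarith [le_abs_self K, abs_nonneg K, norm_nonneg κ]

/-- A `τ`-function is determined by its expansion at `0`. -/
theorem eq_of_hasExpansion {a B c κ : ℂ} {τ₁ τ₂ : ℝ → ℂ} (ha : 0 < a.re) (hκ : κ ≠ 0)
    (hτ₁ : AnalyticOnNhd ℝ τ₁ (Ioo 0 1)) (hτ₂ : AnalyticOnNhd ℝ τ₂ (Ioo 0 1))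
    (hσ₁ : OffDiscrete fun t => SigmaForm (a ^ 2 / 4) B c t (sigma τ₁ t) (deriv (sigma τ₁) t)
      (deriv (deriv (sigma τ₁)) t))
    (hσ₂ : OffDiscrete fun t => SigmaForm (a ^ 2 / 4) B c t (sigma τ₂ t) (deriv (sigma τ₂) t)
      (deriv (deriv (sigma τ₂)) t))
    (h₁ : HasExpansion κ a τ₁) (h₂ : HasExpansion κ a τ₂) :
    EqOn τ₁ τ₂ (Ioo 0 1) := by
  obtain ⟨φ₀, φ₁, φ₂, φ₃, K, y, hφ⟩ := exists_sigmaFlow hτ₁ hσ₁ h₁ ha hκ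
  obtain ⟨ψ₀, ψ₁, ψ₂, ψ₃, K', y', hψ⟩ := exists_sigmaFlow hτ₂ hσ₂ h₂ ha hκ
  obtain ⟨f₁, g₁, b₁⟩ := hφ (min y y') (min_le_left _ _)
  obtain ⟨f₂, g₂, b₂⟩ := hψ (min y y') (min_le_right _ _)
  obtain ⟨x₁, hx₁, heq⟩ := f₁.unique (M := max K K') (M' := 2 * (K + K')) ha f₂ g₁ g₂
    (fun x hx => (b₁ x hx).2.1.trans (by gcongr; exact le_max_left _ _))
    (fun x hx => (b₂ x hx).2.1.trans (by gcongr; exact le_max_right _ _))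
    (fun x hx => by
      have h := norm_log_sub_log_le (b₁ x hx).1 (b₂ x hx).1
      have hs := norm_sub_le (τ₁ (Real.exp x) - (1 - κ * ((Real.exp x : ℝ) : ℂ) ^ (1 + a)))
        (τ₂ (Real.exp x) - (1 - κ * ((Real.exp x : ℝ) : ℂ) ^ (1 + a)))
      rw [sub_sub_sub_cancel_right] at hs
      linarith [(b₁ x hx).2.2, (b₂ x hx).2.2])
  have hball0 : ∀ u ∈ Metric.ball (1 : ℂ) (1 / 2), u ≠ 0 := by
    rintro u hu rfl
    rw [mem_ball_iff_norm, zero_sub, norm_neg, norm_one] at hu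
    norm_num at hu
  have hnear : ∀ t ∈ Ioo 0 (Real.exp x₁), τ₁ t = τ₂ t := by
    intro t ht
    have hle : Real.log t ≤ x₁ := by
      have := Real.log_le_log ht.1 ht.2.le
      rwa [Real.log_exp] at this
    have h := heq _ hle
    have n₁ := hball0 _ (b₁ _ (hle.trans hx₁)).1
    have n₂ := hball0 _ (b₂ _ (hle.trans hx₁)).1
    rw [Real.exp_log ht.1] at h n₁ n₂
    rw [← Complex.exp_log n₁, h, Complex.exp_log n₂]
  set δ := min (Real.exp x₁) 1 with hδ
  have hδ0 : 0 < δ := lt_min (Real.exp_pos _) one_pos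
  have hmem : δ / 2 ∈ Ioo 0 (Real.exp x₁) :=
    ⟨by positivity, by linarith [min_le_left (Real.exp x₁) 1]⟩
  refine hτ₁.eqOn_of_preconnected_of_eventuallyEq hτ₂ isPreconnected_Ioo
    (z₀ := δ / 2) ⟨hmem.1, by linarith [min_le_right (Real.exp x₁) 1]⟩ ?_
  filter_upwards [isOpen_Ioo.mem_nhds hmem] with t ht
  exact hnear t ht

end PVI

/-! ### The constants `κ` and `κ_PBT`. -/

namespace Hypergeometric

theorem IsTau.hasExpansion {z z' w w' : ℂ} {D : ℝ → ℂ} (h : IsTau z z' w w' D) :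
    PVI.HasExpansion (kappa z z' w w') (z + z' + w + w') D := by
  have := h.2
  unfold PVI.HasExpansion
  simpa only [← add_assoc] using this

theorem kappa_ne_zero {z z' w w' : ℂ} (h : Admissible z z' w w')
    (hs : Complex.sin (Real.pi * z) * Complex.sin (Real.pi * z') ≠ 0) : kappa z z' w w' ≠ 0 := by
  obtain ⟨hint, hre⟩ := h
  have hΓ : ∀ u : ℂ, (∀ n : ℤ, n < 0 → u ≠ n) → Complex.Gamma (1 + u) ≠ 0 := by
    intro u hu
    refine Complex.Gamma_ne_zero fun m hm => hu (-(m : ℤ) - 1) (by omega) ?_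
    push_cast
    linear_combination hm
  have h₁ := hΓ (z + w) fun n hn => (hint n hn).1
  have h₂ := hΓ (z + w') fun n hn => (hint n hn).2.1
  have h₃ := hΓ (z' + w) fun n hn => (hint n hn).2.2.1
  have h₄ := hΓ (z' + w') fun n hn => (hint n hn).2.2.2
  have h₅ : Complex.Gamma (2 + z + z' + w + w') ≠ 0 := by
    refine Complex.Gamma_ne_zero_of_re_pos ?_
    simp only [Complex.add_re, Complex.re_ofNat] at hre ⊢
    linarith
  simp only [← add_assoc] at h₁ h₂ h₃ h₄
  have hπ : (Real.pi : ℂ) ≠ 0 := by exact_mod_cast Real.pi_ne_zero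
  unfold kappa
  exact mul_ne_zero (div_ne_zero hs (pow_ne_zero 2 hπ)) (div_ne_zero
    (mul_ne_zero (mul_ne_zero (mul_ne_zero h₁ h₂) h₃) h₄) (mul_ne_zero h₅ h₅))

end Hypergeometric

namespace PalmerBeattyTracy

theorem IsTau.hasExpansion {ν₁ ν₂ b : ℝ} {μ : ℂ} {τ : ℝ → ℂ} (h : IsTau ν₁ ν₂ b μ τ) :
    PVI.HasExpansion (kappa ν₁ ν₂ b μ) (2 * μ) fun t => τ (1 - t) := by
  have hc : Tendsto (fun t : ℝ => 1 - t) (𝓝[>] 0) (𝓝[<] 1) := by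
    refine tendsto_nhdsWithin_iff.2 ⟨?_, ?_⟩
    · have h : Continuous fun t : ℝ => 1 - t := by fun_prop
      exact (h.tendsto' 0 1 (sub_zero 1)).mono_left nhdsWithin_le_nhds
    · filter_upwards [self_mem_nhdsWithin] with t ht
      rw [mem_Ioi] at ht
      rw [mem_Iio]
      linarith
  have := h.2.2.comp_tendsto hc
  unfold PVI.HasExpansion
  simpa only [Function.comp_def, sub_sub_cancel] using this

/-- The product-to-sum formula needs only the difference of the arguments and the cosine of their
sum, which is why the relation between `z + z'` and `ν₁ + ν₂` enters through a cosine. -/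
theorem sin_mul_sin_eq {z z' : ℂ} {ν₁ ν₂ : ℝ} (hz : z - z' = ν₁ - ν₂)
    (hcos : Complex.cos (Real.pi * (z + z')) = Complex.cos (Real.pi * (ν₁ + ν₂))) :
    Complex.sin (Real.pi * z) * Complex.sin (Real.pi * z') =
      Complex.sin (Real.pi * ν₁) * Complex.sin (Real.pi * ν₂) := by
  have hprod : ∀ x y : ℂ, Complex.sin (Real.pi * x) * Complex.sin (Real.pi * y) =
      (Complex.cos (Real.pi * (x - y)) - Complex.cos (Real.pi * (x + y))) / 2 := by
    intro x y
    rw [mul_sub, mul_add, Complex.cos_sub, Complex.cos_add]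
    ring
  rw [hprod, hprod, hz, hcos]

theorem kappa_eq {z z' w w' μ : ℂ} {ν₁ ν₂ b : ℝ} (hsum : z + z' + w + w' = 2 * μ)
    (hz : z - z' = ν₁ - ν₂) (hw : w - w' = 2 + ν₁ + ν₂ - 2 * b)
    (hcos : Complex.cos (Real.pi * (z + z')) = Complex.cos (Real.pi * (ν₁ + ν₂))) :
    Hypergeometric.kappa z z' w w' = kappa ν₁ ν₂ b μ := by
  -- The Gamma factors agree one by one, up to their order.
  have e₁ : 1 + z + w = 2 + μ + ν₁ - b := by linear_combination (hsum + hz + hw) / 2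
  have e₂ : 1 + z + w' = μ - ν₂ + b := by linear_combination (hsum + hz - hw) / 2
  have e₃ : 1 + z' + w = 2 + μ + ν₂ - b := by linear_combination (hsum - hz + hw) / 2
  have e₄ : 1 + z' + w' = μ - ν₁ + b := by linear_combination (hsum - hz - hw) / 2
  have e₅ : 2 + z + z' + w + w' = 2 + 2 * μ := by linear_combination hsum
  unfold Hypergeometric.kappa kappa
  rw [sin_mul_sin_eq hz hcos, e₁, e₂, e₃, e₄, e₅]
  ring

theorem sin_pi_mul_ne_zero {ν : ℝ} (hν : -1 < ν ∧ ν < 0) : Complex.sin (Real.pi * ν) ≠ 0 := by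
  have h := Real.sin_neg_of_neg_of_neg_pi_lt (x := Real.pi * ν)
    (mul_neg_of_pos_of_neg Real.pi_pos hν.2) (by nlinarith [Real.pi_pos, hν.1])
  exact_mod_cast h.ne

end PalmerBeattyTracy

/-! ### Matching of the parameters. -/

theorem lemma4p1
    (z z' w w' μ : ℂ) (ν₁ ν₂ b : ℝ)
    (hν₁ : -1 < ν₁ ∧ ν₁ < 0) (hν₂ : -1 < ν₂ ∧ ν₂ < 0)
    (hadm : Hypergeometric.Admissible z z' w w')
    (hsum : z + z' + w + w' = 2 * μ)
    (hz : z - z' = ν₁ - ν₂)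
    (hw : w - w' = 2 + ν₁ + ν₂ - 2 * b)
    (hcos : Complex.cos (Real.pi * (z + z')) = Complex.cos (Real.pi * (ν₁ + ν₂)))
    (D τ : ℝ → ℂ)
    (hD : Hypergeometric.IsTau z z' w w' D)
    (hτ : PalmerBeattyTracy.IsTau ν₁ ν₂ b μ τ) :
    ∀ t ∈ Set.Ioo (0 : ℝ) 1, D t = τ (1 - t) := by
  have hre : 0 < (2 * μ).re := hsum ▸ hadm.2
  have hκ : PalmerBeattyTracy.kappa ν₁ ν₂ b μ ≠ 0 := by
    rw [← PalmerBeattyTracy.kappa_eq hsum hz hw hcos]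
    refine Hypergeometric.kappa_ne_zero hadm ?_
    rw [PalmerBeattyTracy.sin_mul_sin_eq hz hcos]
    exact mul_ne_zero (PalmerBeattyTracy.sin_pi_mul_ne_zero hν₁)
      (PalmerBeattyTracy.sin_pi_mul_ne_zero hν₂)
  have hDexp := hD.hasExpansion
  rw [PalmerBeattyTracy.kappa_eq hsum hz hw hcos, hsum] at hDexp
  have hDσ := hD.1.offDiscrete_sigmaForm rfl
  simp only [hsum] at hDσ
  obtain ⟨u, hu, hτu⟩ := hτ.2.1
  have hτσ := hu.offDiscrete_sigmaForm rfl hτu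
  -- The two triples of squared exponents coincide: `θ_t = 2μ`, `θ_∞ - 1 = z - z'` and `θ₀ + 1 = w -
  -- w'`.
  have e₁ : ((PalmerBeattyTracy.params ν₁ ν₂ b μ).t / 2) ^ 2 = (2 * μ) ^ 2 / 4 := by
    simp only [PalmerBeattyTracy.params]
    ring
  have e₂ : (((PalmerBeattyTracy.params ν₁ ν₂ b μ).inf - 1) / 2) ^ 2 = (z - z') ^ 2 / 4 := by
    simp only [PalmerBeattyTracy.params, hz]
    ring
  have e₃ : (((PalmerBeattyTracy.params ν₁ ν₂ b μ).zero + 1) / 2) ^ 2 = (w - w') ^ 2 / 4 := by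
    simp only [PalmerBeattyTracy.params, hw]
    ring
  rw [e₁, e₂, e₃] at hτσ
  have hτan : AnalyticOnNhd ℝ (fun t => τ (1 - t)) (Ioo 0 1) := by
    intro t ht
    have h : AnalyticAt ℝ (fun r : ℝ => 1 - r) t := by fun_prop
    exact (hτ.1 (1 - t) ⟨by linarith [ht.2], by linarith [ht.1]⟩).fun_comp h
  exact PVI.eq_of_hasExpansion hre hκ hD.1.1 hτan (hDσ.mono fun _ _ h => h.2)
    (hτσ.mono fun _ _ h => h.2) hDexp hτ.hasExpansion
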